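/- Let $\mu$ be a probability distribution on $\mathbb R$ with $\int |x|^3\,\mu(dx)<\infty$, mean $m_1$ and variance $\sigma_0^2>0$, and let $p\in[1/2,1)$. Let $X_1,X_2,\dots$ be i.i.d. with distribution $\mu$; let $\epsilon_1=1$ and let $\epsilon_2,\epsilon_3,\dots$ be i.i.d. Bernoulli variables with $\mathbb P(\epsilon_n=1)=p=1-\mathbb P(\epsilon_n=0)$; let $U_2,U_3,\dots$ be independent with $U_n$ uniform on $\{1,\dots,n-1\}$; and let the three sequences $(X_n)$, $(\epsilon_n)$, $(U_n)$ be independent of each other. Put $\mathrm i(n)=\sum_{j=1}^n\epsilon_j$, $\hat X_1=X_1$ and, for $n\ge2$, $$\hat X_n=\begin{cases}\hat X_{U_n},&\epsilon_n=0,\\ X_{\mathrm i(n)},&\epsilon_n=1,\end{cases}\qquad \hat S_n=\sum_{i=1}^n\hat X_i$$ (the positively step-reinforced random walk). Let $$b_n=\begin{cases}\dfrac{n}{2p-1}-\dfrac{n^{2-2p}}{(2p-1)\Gamma(2-2p)},&p>1/2,\\[2mm] n\log n+\gamma n,&p=1/2,\end{cases}\qquad \delta_{1,n}=\begin{cases}n^{-1/2},&p>2/3,\\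 n^{-1/2}\log n,&p=2/3,\\ n^{3/2-3p},&1/2<p<2/3,\\ (\log n)^{-3/2},&p=1/2,\end{cases}$$ where $\Gamma$ is the Gamma function and $\gamma$ is Euler's constant. Then there is a constant $C>0$, depending only on $p$ and $\mu$ (in particular not on $n$), such that $$\sup_{x\in\mathbb R}\left|\mathbb P\left(\frac{\hat S_n-m_1n}{\sigma_0\sqrt{b_n}}\le x\right)-\Phi(x)\right|\le C\,\delta_{1,n}$$ for all $n\ge 2$, and also for $n=1$ if $p\notin\{1/2,2/3\}$, where $\Phi$ is the standard normal distribution function. -/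

import Mathlib

open MeasureTheory ProbabilityTheory

namespace StepReinforced

/-- `i(n) = ∑_{j=1}^n ε_j`, along one sample path `e` of `(ε_n)`. -/
def newCount (e : ℕ → ℕ) (n : ℕ) : ℕ := ∑ j ∈ Finset.Icc 1 n, e j

/-- The `n`-th step `X̂_n` (`n ≥ 1`) of the positively step-reinforced walk along one sample path
`x, e, u` of `(X_n), (ε_n), (U_n)`. Almost surely `1 ≤ u n ≤ n - 1` and `e n ∈ {0, 1}` for all
`n ≥ 2`; the value at `n = 0` and the value chosen when `n ≤ u n` play no role. -/
def step (x : ℕ → ℝ) (e u : ℕ → ℕ) : ℕ → ℝ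
  | 0 => 0
  | 1 => x 1
  | n + 2 =>
    if e (n + 2) = 0 then
      if _h : u (n + 2) < n + 2 then step x e u (u (n + 2)) else 0
    else x (newCount e (n + 2))
termination_by n => n

/-- The walk `Ŝ_n = ∑_{i=1}^n X̂_i` along one sample path. -/
def walk (x : ℕ → ℝ) (e u : ℕ → ℕ) (n : ℕ) : ℝ := ∑ i ∈ Finset.Icc 1 n, step x e u i

/-- The driving sequences `(X_n)_{n ≥ 1}`, `(ε_n)_{n ≥ 1}`, `(U_n)_{n ≥ 2}` of a step-reinforced
random walk with step distribution `μ` and parameter `p`. Nothing is required of `X 0`, `ε 0`,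
`U 0`, `U 1`. -/
structure IsDriving {Ω : Type*} [MeasurableSpace Ω] (P : Measure Ω) (μ : Measure ℝ) (p : ℝ)
    (X : ℕ → Ω → ℝ) (ε U : ℕ → Ω → ℕ) : Prop where
  measurable_X : ∀ n, 1 ≤ n → Measurable (X n)
  measurable_ε : ∀ n, 2 ≤ n → Measurable (ε n)
  measurable_U : ∀ n, 2 ≤ n → Measurable (U n)
  /-- each `X_n` has distribution `μ` -/
  law_X : ∀ n, 1 ≤ n → P.map (X n) = μ
  ε_one : ∀ ω, ε 1 ω = 1
  /-- each `ε_n`, `n ≥ 2`, is Bernoulli with parameter `p` -/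
  law_ε_one : ∀ n, 2 ≤ n → P {ω | ε n ω = 1} = ENNReal.ofReal p
  law_ε_zero : ∀ n, 2 ≤ n → P {ω | ε n ω = 0} = ENNReal.ofReal (1 - p)
  /-- each `U_n`, `n ≥ 2`, is uniform on `{1, …, n - 1}` -/
  law_U : ∀ n, 2 ≤ n → ∀ k, 1 ≤ k → k < n →
    P {ω | U n ω = k} = ENNReal.ofReal (1 / ((n : ℝ) - 1))
  indep_X : iIndepFun (fun n => X (n + 1)) P
  indep_ε : iIndepFun (fun n => ε (n + 2)) P
  indep_U : iIndepFun (fun n => U (n + 2)) P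
  /-- the three sequences are mutually independent: `(X_n)` is independent of the pair
  `((ε_n), (U_n))`, and `(ε_n)` is independent of `(U_n)` -/
  indep_X_εU : IndepFun (fun ω (n : ℕ) => X (n + 1) ω)
    (fun ω => ((fun n : ℕ => ε (n + 2) ω), (fun n : ℕ => U (n + 2) ω))) P
  indep_ε_U : IndepFun (fun ω (n : ℕ) => ε (n + 2) ω) (fun ω (n : ℕ) => U (n + 2) ω) P

/-- The Kolmogorov distance between the random variable `Y` and a standard normal variable. -/
noncomputable def kolmogorovDist {Ω : Type*} [MeasurableSpace Ω] (P : Measure Ω) (Y : Ω → ℝ) : ℝ :=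
  ⨆ x : ℝ, |P.real {ω | Y ω ≤ x} - cdf (gaussianReal 0 1) x|

/-- The variance sequence `b_n`, for `p ∈ [1/2, 1)`. -/
noncomputable def b (p : ℝ) (n : ℕ) : ℝ :=
  if p = 1 / 2 then (n : ℝ) * Real.log n + Real.eulerMascheroniConstant * n
  else (n : ℝ) / (2 * p - 1) - (n : ℝ) ^ (2 - 2 * p) / ((2 * p - 1) * Real.Gamma (2 - 2 * p))

/-- The rate `δ_{1,n}`, for `p ∈ [1/2, 1)`; the last case is `p = 1/2`. -/
noncomputable def rate (p : ℝ) (n : ℕ) : ℝ :=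
  if 2 / 3 < p then (n : ℝ) ^ (-(1 / 2) : ℝ)
  else if p = 2 / 3 then (n : ℝ) ^ (-(1 / 2) : ℝ) * Real.log n
  else if 1 / 2 < p then (n : ℝ) ^ (3 / 2 - 3 * p)
  else Real.log n ^ (-(3 / 2) : ℝ)

end StepReinforced

namespace StepReinforced

open Real Set Filter Topology

/-! ### The Fejér kernel -/

/-! Attach to each step the label of the innovation it repeats. The labels depend on (ε_n) and (U_n)
only, so they are independent of (X_n). Given them, Ŝ_n = ∑ N_j X_j is a weighted sum of i.i.d.
variables, where N_j is the number of steps with label j. Put V = ∑ N_j² and T = ∑ N_j³.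

The Berry–Esseen theorem for weighted sums (`exists_berry_esseen_weighted`, obtained by Fejér
smoothing and comparison of characteristic functions) puts the conditional law of the centred walk
within C T / V^(3/2) of a normal law with variance σ₀² V. Expanding Φ(x / √(V / b_n)) around V = b_n
(`abs_cdf_gaussianReal_div_sqrt_sub_le`) gives a term linear in V / b_n - 1 and a quadratic
remainder, uniformly in x. The linear term is averaged over the labels before absolute values are
taken (`exists_distribution_bound`), so it contributes only the bias |E V - b_n| / b_n and not the
standard deviation of V / b_n. What remains is to bound E T / b_n^(3/2), Var V / b_n² and |E V -
b_n| / b_n.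

A copying step repeats a uniform past step, hence joins a block with probability proportional to its
size (`integral_copy`). With q = 1 - p this yields recursions for E V, E T and Var V with
multipliers 1 + 2q/n, 1 + 3q/n and 1 + 4q/n. The first has a closed form, which b_n matches up to
O(1). The second gives E T = O(n), O(n log n) or O(n^(3q)) for q <, =, > 1/3, and this term dictates
the rate (`exists_errorBound`); at p = 1/2 the logarithm comes from b_n being of order n log n. The
variance and bias terms are no larger. Finitely many small n are absorbed into the constant. -/

/-- The (unnormalised) Fejér kernel, as the cosine transform of a triangle. -/
noncomputable def fejer (z : ℝ) : ℝ := ∫ t in (0 : ℝ)..1, (1 - t) * cos (t * z)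

lemma fejer_of_ne_zero {z : ℝ} (hz : z ≠ 0) : fejer z = (1 - cos z) / z ^ 2 := by
  have h : ∀ t ∈ uIcc (0 : ℝ) 1, HasDerivAt
      (fun t => (1 - t) * sin (t * z) / z - cos (t * z) / z ^ 2) ((1 - t) * cos (t * z)) t := by
    intro t _
    have h1 : HasDerivAt (fun t : ℝ => t * z) z t := by simpa using (hasDerivAt_id t).mul_const z
    have h2 : HasDerivAt (fun t : ℝ => 1 - t) (-1) t := by simpa using (hasDerivAt_id t).const_sub 1
    convert! (((h2.mul h1.sin).div_const z).sub (h1.cos.div_const (z ^ 2))) using 1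
    field_simp
    ring
  rw [fejer, intervalIntegral.integral_eq_sub_of_hasDerivAt h
    (by apply Continuous.intervalIntegrable; fun_prop)]
  simp
  ring

lemma fejer_zero : fejer 0 = 1 / 2 := by
  simp only [fejer, mul_zero, cos_zero, mul_one]
  rw [intervalIntegral.integral_sub (by simp) (by simp)]
  simp
  norm_num

lemma continuous_fejer : Continuous fejer := by
  unfold fejer
  exact intervalIntegral.continuous_parametric_intervalIntegral_of_continuous'
    (f := fun z t => (1 - t) * cos (t * z)) (by fun_prop) 0 1

lemma fejer_nonneg (z : ℝ) : 0 ≤ fejer z := by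
  rcases eq_or_ne z 0 with rfl | hz
  · rw [fejer_zero]; norm_num
  · rw [fejer_of_ne_zero hz]
    have := cos_le_one z
    exact div_nonneg (by linarith) (sq_nonneg z)

lemma fejer_le (z : ℝ) : fejer z ≤ 3 * (1 + z ^ 2)⁻¹ := by
  rcases eq_or_ne z 0 with rfl | hz
  · rw [fejer_zero]; norm_num
  · have h0 : 0 < z ^ 2 := by positivity
    have h1 : fejer z ≤ 1 / 2 := by
      rw [fejer_of_ne_zero hz, div_le_iff₀ h0]
      have := one_sub_sq_div_two_le_cos (x := z)
      linarith
    have h2 : fejer z * z ^ 2 ≤ 2 := by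
      rw [fejer_of_ne_zero hz, div_mul_cancel₀ _ h0.ne']
      have := neg_one_le_cos z
      linarith
    rw [← div_eq_mul_inv, le_div_iff₀ (by positivity)]
    linarith

lemma integrable_fejer : Integrable fejer := by
  refine (integrable_inv_one_add_sq.const_mul 3).mono' continuous_fejer.aestronglyMeasurable ?_
  refine Eventually.of_forall fun z => ?_
  rw [Real.norm_of_nonneg (fejer_nonneg z)]
  exact fejer_le z

lemma integral_fejer_pos : 0 < ∫ z, fejer z := by
  rw [integral_pos_iff_support_of_nonneg fejer_nonneg integrable_fejer]
  refine IsOpen.measure_pos _ continuous_fejer.isOpen_support ⟨0, ?_⟩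
  simp [fejer_zero]

/-- Writing `sinc` instead of sin (t z) / t keeps the integrand continuous at t = 0, which the later
exchanges of integrals rely on. -/
lemma integral_cos_mul_eq (t z : ℝ) : ∫ s in (0 : ℝ)..z, cos (t * s) = z * sinc (t * z) := by
  rcases eq_or_ne t 0 with rfl | ht
  · simp
  · rw [intervalIntegral.integral_comp_mul_left (f := cos) ht]
    rcases eq_or_ne z 0 with rfl | hz
    · simp
    · rw [sinc_of_ne_zero (mul_ne_zero ht hz)]
      simp
      field_simp

lemma integral_fejer_eq (z : ℝ) :
    ∫ s in (0 : ℝ)..z, fejer s = ∫ t in (0 : ℝ)..1, (1 - t) * (z * sinc (t * z)) := by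
  unfold fejer
  rw [intervalIntegral_intervalIntegral_swap]
  · simp_rw [intervalIntegral.integral_const_mul, integral_cos_mul_eq]
  · have : Continuous (Function.uncurry fun x t : ℝ => (1 - t) * cos (t * x)) := by
      unfold Function.uncurry; fun_prop
    refine (this.continuousOn.integrableOn_compact
      ((isCompact_uIcc (a := (0 : ℝ)) (b := z)).prod (isCompact_uIcc (a := (0 : ℝ)) (b := 1)))).mono_set ?_
    exact prod_mono uIoc_subset_uIcc uIoc_subset_uIcc

/-- The probability law with density proportional to the Fejér kernel. -/
noncomputable def fejerLaw : Measure ℝ :=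
  volume.withDensity fun z => ENNReal.ofReal (fejer z / ∫ z, fejer z)

lemma integrable_fejer_div : Integrable fun z => fejer z / ∫ z, fejer z :=
  integrable_fejer.div_const _

lemma fejer_div_nonneg (z : ℝ) : 0 ≤ fejer z / ∫ z, fejer z :=
  div_nonneg (fejer_nonneg z) integral_fejer_pos.le

instance : IsProbabilityMeasure fejerLaw := by
  constructor
  rw [fejerLaw, withDensity_apply _ MeasurableSet.univ, Measure.restrict_univ,
    ← ofReal_integral_eq_lintegral_ofReal integrable_fejer_div
      (Eventually.of_forall fejer_div_nonneg), integral_div, div_self integral_fejer_pos.ne']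
  simp

/-- The kernel has a bounded frequency range, and so has this formula; it later confines the
comparison of characteristic functions to [0, T]. The value at 0 stays implicit because it cancels
in differences. -/
lemma fejerLaw_real_Iic (z : ℝ) :
    fejerLaw.real (Iic z) = fejerLaw.real (Iic 0) +
      (∫ z, fejer z)⁻¹ * ∫ t in (0 : ℝ)..1, (1 - t) * (z * sinc (t * z)) := by
  have h (w : ℝ) : fejerLaw.real (Iic w) = ∫ s in Iic w, fejer s / ∫ z, fejer z := by
    rw [measureReal_def, fejerLaw, withDensity_apply _ measurableSet_Iic,
      ← ofReal_integral_eq_lintegral_ofReal integrable_fejer_div.integrableOn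
        (Eventually.of_forall fejer_div_nonneg),
      ENNReal.toReal_ofReal (integral_nonneg fejer_div_nonneg)]
  rw [← integral_fejer_eq, h, h, ← sub_eq_iff_eq_add',
    intervalIntegral.integral_Iic_sub_Iic integrable_fejer_div.integrableOn
      integrable_fejer_div.integrableOn, intervalIntegral.integral_div]
  ring

lemma exists_fejerLaw_tail : ∃ c : ℝ, 0 < c ∧ 3 / 4 ≤ fejerLaw.real (Icc (-c) c) := by
  have hm : Monotone fun n : ℕ => Icc (-(n : ℝ)) n := fun a b h =>
    Icc_subset_Icc (by simpa using h) (by simpa using h)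
  have h1 := tendsto_measure_iUnion_atTop (μ := fejerLaw) hm
  have hu : ⋃ n : ℕ, Icc (-(n : ℝ)) n = univ := by
    ext x
    simp only [mem_iUnion, mem_univ, iff_true, mem_Icc]
    obtain ⟨n, hn⟩ := exists_nat_ge |x|
    exact ⟨n, abs_le.1 hn⟩
  rw [hu, measure_univ] at h1
  have h2 : Tendsto (fun n : ℕ => fejerLaw.real (Icc (-(n : ℝ)) n)) atTop (𝓝 1) := by
    exact (ENNReal.tendsto_toReal ENNReal.one_ne_top).comp h1
  obtain ⟨n, hn, hn1⟩ := ((h2.eventually (lt_mem_nhds (by norm_num : (3 / 4 : ℝ) < 1))).and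
    (eventually_ge_atTop 1)).exists
  exact ⟨n, by positivity, hn.le⟩

/-! ### Esseen's smoothing inequality -/

/-- Fubini: both sides are the probability of u + y / T ≤ x for independent u and y with laws `ρ`
and `fejerLaw`. -/
lemma integral_cdf_fejerLaw (ρ : Measure ℝ) [IsProbabilityMeasure ρ] {T : ℝ} (hT : 0 < T) (x : ℝ) :
    ∫ y, cdf ρ (x - y / T) ∂fejerLaw = ∫ u, fejerLaw.real (Iic (T * (x - u))) ∂ρ := by
  have hs : MeasurableSet {z : ℝ × ℝ | z.1 ≤ x - z.2 / T} :=
    measurableSet_le (by fun_prop) (by fun_prop)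
  have h1 : ∀ y, cdf ρ (x - y / T) =
      ∫ u, {z : ℝ × ℝ | z.1 ≤ x - z.2 / T}.indicator (fun _ => (1 : ℝ)) (u, y) ∂ρ := by
    intro y
    rw [cdf_eq_real, ← integral_indicator_one measurableSet_Iic]
    rfl
  have h2 : ∀ u, fejerLaw.real (Iic (T * (x - u))) =
      ∫ y, {z : ℝ × ℝ | z.1 ≤ x - z.2 / T}.indicator (fun _ => (1 : ℝ)) (u, y) ∂fejerLaw := by
    intro u
    rw [← integral_indicator_one measurableSet_Iic]
    congr 1 with y
    simp only [indicator, mem_Iic, mem_ofPred_eq, Pi.one_apply]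
    have : y ≤ T * (x - u) ↔ u ≤ x - y / T := by
      rw [le_sub_comm, div_le_iff₀ hT, mul_comm]
    simp [this]
  simp_rw [h1, h2]
  refine (integral_integral_swap (f := fun u y =>
    {z : ℝ × ℝ | z.1 ≤ x - z.2 / T}.indicator (fun _ => (1 : ℝ)) (u, y)) ?_).symm
  exact (integrable_const 1).indicator hs

/-- Domination by |T (x - u)|, from |1 - t| ≤ 1 and |sinc| ≤ 1; this is where a first moment of `ρ`
enters. -/
lemma integrable_sinc_prod (ρ : Measure ℝ) [IsProbabilityMeasure ρ] (hρ : Integrable id ρ)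
    (T x : ℝ) : Integrable (Function.uncurry fun t u : ℝ =>
      (1 - t) * ((T * (x - u)) * sinc (t * (T * (x - u)))))
      ((volume.restrict (uIoc 0 1)).prod ρ) := by
  have : IsFiniteMeasure (volume.restrict (uIoc (0 : ℝ) 1)) := by
    rw [uIoc_of_le zero_le_one]; infer_instance
  have hi : Integrable (fun u : ℝ => |T * (x - u)|) ρ :=
    (((integrable_const x).sub hρ).const_mul T).abs
  have h2 : Integrable (fun z : ℝ × ℝ => (1 : ℝ) * |T * (x - z.2)|)
      ((volume.restrict (uIoc 0 1)).prod ρ) :=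
    (integrable_const (1 : ℝ)).mul_prod hi
  refine h2.mono' ?_ ?_
  · have : Continuous (Function.uncurry fun t u : ℝ =>
      (1 - t) * ((T * (x - u)) * sinc (t * (T * (x - u))))) := by
      unfold Function.uncurry; fun_prop
    exact this.aestronglyMeasurable
  · have : ∀ᵐ z ∂((volume.restrict (uIoc (0 : ℝ) 1)).prod ρ), z.1 ∈ uIoc (0 : ℝ) 1 :=
      Measure.quasiMeasurePreserving_fst.ae (ae_restrict_mem measurableSet_uIoc)
    filter_upwards [this] with z hz
    rw [uIoc_of_le zero_le_one] at hz
    simp only [Function.uncurry, norm_mul, Real.norm_eq_abs]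
    have h1 : |1 - z.1| ≤ 1 := by rw [abs_le]; constructor <;> linarith [hz.1, hz.2]
    rw [abs_mul T]
    have h3 := abs_sinc_le_one (z.1 * (T * (x - z.2)))
    have h4 : 0 ≤ |T| * |x - z.2| := by positivity
    calc |1 - z.1| * (|T| * |x - z.2| * |sinc (z.1 * (T * (x - z.2)))|)
        ≤ 1 * (|T| * |x - z.2| * 1) := by gcongr
      _ = _ := by ring

lemma integral_cdf_fejerLaw_eq (ρ : Measure ℝ) [IsProbabilityMeasure ρ] (hρ : Integrable id ρ)
    {T : ℝ} (hT : 0 < T) (x : ℝ) :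
    ∫ y, cdf ρ (x - y / T) ∂fejerLaw = fejerLaw.real (Iic 0) + (∫ z, fejer z)⁻¹ *
      ∫ t in (0 : ℝ)..1, ∫ u, (1 - t) * ((T * (x - u)) * sinc (t * (T * (x - u)))) ∂ρ := by
  rw [integral_cdf_fejerLaw ρ hT x]
  simp_rw [fejerLaw_real_Iic (T * _)]
  rw [intervalIntegral_integral_swap (integrable_sinc_prod ρ hρ T x), integral_add
    (integrable_const _), integral_const_mul]
  · simp
  · refine Integrable.const_mul ?_ _
    have := (integrable_sinc_prod ρ hρ T x).integral_prod_right
    simpa only [Function.uncurry, intervalIntegral.integral_of_le zero_le_one,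
      uIoc_of_le (zero_le_one (α := ℝ))] using this

/-- The sine integral is, up to sign, the imaginary part of the characteristic function times the
unimodular factor exp (-i s x). -/
lemma abs_integral_sin_sub_le (ρ ν : Measure ℝ) [IsProbabilityMeasure ρ] [IsProbabilityMeasure ν]
    (s x : ℝ) : |∫ u, sin (s * (x - u)) ∂ρ - ∫ u, sin (s * (x - u)) ∂ν|
      ≤ ‖charFun ρ s - charFun ν s‖ := by
  have h (η : Measure ℝ) [IsProbabilityMeasure η] : ∫ u, sin (s * (x - u)) ∂η =
      -(Complex.exp (-(s * x * Complex.I)) * charFun η s).im := by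
    have hi : Integrable (fun u : ℝ => Complex.exp (-(s * x * Complex.I)) *
        Complex.exp (s * u * Complex.I)) η := by
      refine (integrable_const (1 : ℝ)).mono' (by fun_prop) (Eventually.of_forall fun u => ?_)
      rw [← Complex.exp_add, Complex.norm_exp]
      simp
    rw [charFun_apply_real, ← integral_const_mul]
    have := integral_im (𝕜 := ℂ) hi
    simp only [RCLike.im_to_complex] at this
    rw [← this, ← integral_neg]
    congr 1 with u
    rw [← Complex.exp_add]
    have : -(s * x * Complex.I) + s * u * Complex.I = ((-(s * (x - u)) : ℝ) : ℂ) * Complex.I := by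
      push_cast; ring
    rw [this, Complex.exp_ofReal_mul_I_im, sin_neg, neg_neg]
  rw [h, h]
  have : -(Complex.exp (-(s * x * Complex.I)) * charFun ρ s).im -
      -(Complex.exp (-(s * x * Complex.I)) * charFun ν s).im =
      -(Complex.exp (-(s * x * Complex.I)) * (charFun ρ s - charFun ν s)).im := by
    rw [mul_sub, Complex.sub_im]; ring
  rw [this, abs_neg]
  refine (Complex.abs_im_le_norm _).trans ?_
  rw [norm_mul, Complex.norm_exp]
  simp

/-- The constant `fejerLaw.real (Iic 0)` cancels, and for z = T (x - u) the factor z sinc (t z)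
equals sin (t T (x - u)) / t. This is the origin of the division by t in the hypothesis on `g`. -/
lemma abs_integral_cdf_sub_le (ρ ν : Measure ℝ) [IsProbabilityMeasure ρ] [IsProbabilityMeasure ν]
    (hρ : Integrable id ρ) (hν : Integrable id ν) {T : ℝ} (hT : 0 < T) {g : ℝ → ℝ}
    (hg : IntervalIntegrable g volume 0 1)
    (h : ∀ t ∈ Ioc (0 : ℝ) 1, ‖charFun ρ (t * T) - charFun ν (t * T)‖ / t ≤ g t) (x : ℝ) :
    |∫ y, (cdf ρ (x - y / T) - cdf ν (x - y / T)) ∂fejerLaw| ≤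
      (∫ z, fejer z)⁻¹ * ∫ t in (0 : ℝ)..1, g t := by
  have hc (η : Measure ℝ) : Integrable (fun y => cdf η (x - y / T)) fejerLaw := by
    refine (integrable_const (1 : ℝ)).mono' ?_ (Eventually.of_forall fun y => ?_)
    · exact ((monotone_cdf η).measurable.comp (by fun_prop)).aestronglyMeasurable
    · rw [Real.norm_of_nonneg (cdf_nonneg _ _)]
      exact cdf_le_one _ _
  have hI (η : Measure ℝ) [IsProbabilityMeasure η] (hη : Integrable id η) :
      IntervalIntegrable (fun t => ∫ u, (1 - t) * ((T * (x - u)) * sinc (t * (T * (x - u)))) ∂η)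
        volume 0 1 := by
    rw [intervalIntegrable_iff]
    exact (integrable_sinc_prod η hη T x).integral_prod_left
  rw [integral_sub (hc ρ) (hc ν), integral_cdf_fejerLaw_eq ρ hρ hT,
    integral_cdf_fejerLaw_eq ν hν hT, add_sub_add_left_eq_sub, ← mul_sub,
    ← intervalIntegral.integral_sub (hI ρ hρ) (hI ν hν), abs_mul,
    abs_of_pos (inv_pos.2 integral_fejer_pos)]
  refine mul_le_mul_of_nonneg_left ?_ (inv_pos.2 integral_fejer_pos).le
  rw [← Real.norm_eq_abs]
  refine intervalIntegral.norm_integral_le_of_norm_le zero_le_one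
    (Eventually.of_forall fun t ht => ?_) hg
  refine le_trans ?_ (h t ht)
  have hs (u : ℝ) : (T * (x - u)) * sinc (t * (T * (x - u))) = sin ((t * T) * (x - u)) / t := by
    rcases eq_or_ne (x - u) 0 with h0 | h0
    · simp [h0]
    · rw [sinc_of_ne_zero (mul_ne_zero ht.1.ne' (mul_ne_zero hT.ne' h0))]
      have := ht.1.ne'
      field_simp
  simp_rw [hs, integral_const_mul, integral_div]
  rw [← mul_sub, ← sub_div, norm_mul, norm_div, Real.norm_eq_abs, Real.norm_eq_abs,
    Real.norm_eq_abs, abs_of_pos ht.1]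
  have h1 : |1 - t| ≤ 1 := by rw [abs_le]; constructor <;> linarith [ht.1, ht.2]
  have h2 := abs_integral_sin_sub_le ρ ν (t * T) x
  have := ht.1
  calc _ ≤ 1 * (‖charFun ρ (t * T) - charFun ν (t * T)‖ / t) := by gcongr
    _ = _ := one_mul _

/-- Centring at x₀ + h makes the window |y| ≤ c sample D on [x₀, x₀ + 2h], where D ≥ η - ε - 2mh;
outside it only D ≥ -η is known. Mass at least 3/4 in the window gives 3/4 (η - ε - 2mh) - η/4, and
`hpos` says that a larger mass only helps. -/
lemma sub_le_integral_of_forall_ge {D : ℝ → ℝ} (hD : Measurable D) {η ε m h c T x₀ : ℝ}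
    (hη : ∀ x, |D x| ≤ η) (hT : 0 < T) (hh : h = c / T) (hm : 0 ≤ m)
    (hc : 3 / 4 ≤ fejerLaw.real (Icc (-c) c))
    (hx : ∀ s, 0 ≤ s → η - ε - m * s ≤ D (x₀ + s)) (hpos : 0 ≤ 2 * η - ε - 2 * m * h) :
    η / 2 - 3 / 4 * (ε + 2 * m * h) ≤ ∫ y, D (x₀ + h - y / T) ∂fejerLaw := by
  have hi : Integrable (fun y => D (x₀ + h - y / T)) fejerLaw :=
    (integrable_const η).mono' (by exact (hD.comp (by fun_prop)).aestronglyMeasurable)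
      (Eventually.of_forall fun y => hη _)
  have hint : Integrable (fun y => -η + (Icc (-c) c).indicator
      (fun _ => 2 * η - ε - 2 * m * h) y) fejerLaw :=
    (integrable_const _).add ((integrable_const _).indicator measurableSet_Icc)
  have hle : ∀ y, -η + (Icc (-c) c).indicator (fun _ => 2 * η - ε - 2 * m * h) y ≤
      D (x₀ + h - y / T) := by
    intro y
    by_cases hy : y ∈ Icc (-c) c
    · rw [indicator_of_mem hy]
      have h1 : y / T ≤ h := by rw [hh]; gcongr; exact hy.2
      have h2 : -h ≤ y / T := by rw [hh, ← neg_div]; gcongr; exact hy.1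
      have h3 := hx (h - y / T) (by linarith)
      have h4 : m * (h - y / T) ≤ m * (2 * h) := by gcongr; linarith
      rw [← add_sub_assoc] at h3
      linarith
    · rw [indicator_of_notMem hy]
      linarith [(abs_le.1 (hη (x₀ + h - y / T))).1]
  refine le_trans ?_ (integral_mono hint hi hle)
  rw [integral_add (integrable_const _) ((integrable_const _).indicator measurableSet_Icc),
    integral_indicator measurableSet_Icc]
  simp only [integral_const, probReal_univ, smul_eq_mul, one_mul, measureReal_restrict_apply_univ]
  nlinarith

lemma le_integral_of_forall_ge_neg {D : ℝ → ℝ} (hD : Measurable D) {η ε m h c T x₀ : ℝ}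
    (hη : ∀ x, |D x| ≤ η) (hT : 0 < T) (hh : h = c / T) (hm : 0 ≤ m)
    (hc : 3 / 4 ≤ fejerLaw.real (Icc (-c) c))
    (hx : ∀ s, 0 ≤ s → D (x₀ - s) ≤ -(η - ε - m * s)) (hpos : 0 ≤ 2 * η - ε - 2 * m * h) :
    ∫ y, D (x₀ - h - y / T) ∂fejerLaw ≤ -(η / 2 - 3 / 4 * (ε + 2 * m * h)) := by
  have hi : Integrable (fun y => D (x₀ - h - y / T)) fejerLaw :=
    (integrable_const η).mono' (by exact (hD.comp (by fun_prop)).aestronglyMeasurable)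
      (Eventually.of_forall fun y => hη _)
  have hint : Integrable (fun y => η - (Icc (-c) c).indicator
      (fun _ => 2 * η - ε - 2 * m * h) y) fejerLaw :=
    (integrable_const _).sub ((integrable_const _).indicator measurableSet_Icc)
  have hle : ∀ y, D (x₀ - h - y / T) ≤
      η - (Icc (-c) c).indicator (fun _ => 2 * η - ε - 2 * m * h) y := by
    intro y
    by_cases hy : y ∈ Icc (-c) c
    · rw [indicator_of_mem hy]
      have h1 : y / T ≤ h := by rw [hh]; gcongr; exact hy.2
      have h2 : -h ≤ y / T := by rw [hh, ← neg_div]; gcongr; exact hy.1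
      have h3 := hx (h + y / T) (by linarith)
      have h4 : m * (h + y / T) ≤ m * (2 * h) := by gcongr; linarith
      rw [← sub_sub] at h3
      linarith
    · rw [indicator_of_notMem hy]
      linarith [(abs_le.1 (hη (x₀ - h - y / T))).2]
  refine (integral_mono hi hint hle).trans ?_
  rw [integral_sub (integrable_const _) ((integrable_const _).indicator measurableSet_Icc),
    integral_indicator measurableSet_Icc]
  simp only [integral_const, probReal_univ, smul_eq_mul, one_mul, measureReal_restrict_apply_univ]
  nlinarith

/-- **Esseen's smoothing inequality**. -/
theorem exists_smoothing_bound : ∃ A B : ℝ, 0 < A ∧ 0 < B ∧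
    ∀ (ρ ν : Measure ℝ) [IsProbabilityMeasure ρ] [IsProbabilityMeasure ν],
      Integrable id ρ → Integrable id ν → ∀ m : ℝ, 0 ≤ m →
      (∀ x s, 0 ≤ s → cdf ν (x + s) ≤ cdf ν x + m * s) →
      ∀ T : ℝ, 0 < T → ∀ g : ℝ → ℝ, IntervalIntegrable g volume 0 1 →
      (∀ t ∈ Ioc (0 : ℝ) 1, ‖charFun ρ (t * T) - charFun ν (t * T)‖ / t ≤ g t) →
      ∀ x, |cdf ρ x - cdf ν x| ≤ A * (∫ t in (0 : ℝ)..1, g t) + B * (m / T) := by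
  obtain ⟨c, hc0, hc⟩ := exists_fejerLaw_tail
  refine ⟨2 * (∫ z, fejer z)⁻¹, 3 * c, by have := integral_fejer_pos; positivity, by positivity, ?_⟩
  intro ρ ν _ _ hρ hν m hm hlip T hT g hg hgt x
  set D : ℝ → ℝ := fun x => cdf ρ x - cdf ν x with hDdef
  have hDm : Measurable D := (monotone_cdf ρ).measurable.sub (monotone_cdf ν).measurable
  have hD1 : ∀ x, |D x| ≤ 1 := fun x => by
    have h1 := cdf_nonneg ρ x; have h2 := cdf_le_one ρ x
    have h3 := cdf_nonneg ν x; have h4 := cdf_le_one ν x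
    rw [abs_le]; constructor <;> simp only [hDdef] <;> linarith
  have hbdd : BddAbove (range fun x => |D x|) := ⟨1, by rintro _ ⟨x, rfl⟩; exact hD1 x⟩
  set η := ⨆ x, |D x| with hηdef
  have hη : ∀ x, |D x| ≤ η := fun x => le_ciSup hbdd x
  refine (hη x).trans ?_
  set J := (∫ z, fejer z)⁻¹ * ∫ t in (0 : ℝ)..1, g t with hJ
  have hsm := abs_integral_cdf_sub_le ρ ν hρ hν hT hg hgt
  have hJ0 : 0 ≤ J := (abs_nonneg _).trans (hsm 0)
  have key : η ≤ 2 * J + 3 * c * (m / T) := by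
    refine le_of_forall_pos_le_add fun ε hε => ?_
    set h := c / T with hh
    have hh0 : 0 < h := by positivity
    have hmh : 3 * c * (m / T) = 3 * (m * h) := by rw [hh]; ring
    rw [hmh]
    have hmh0 : 0 ≤ m * h := by positivity
    -- If this fails, then η < ε/4 + m h, which is already better than the claim.
    by_cases hpos : 0 ≤ 2 * η - ε / 2 - 2 * m * h
    swap
    · linarith
    obtain ⟨x₀, hx₀⟩ := exists_lt_of_lt_ciSup (show η - ε / 2 < ⨆ x, |D x| by linarith)
    -- Since `cdf ρ` is monotone and `cdf ν` grows at rate at most m, a large positive value of D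
    -- persists to the right of x₀ and a large negative one to the left.
    rcases le_total 0 (D x₀) with hs | hs
    · rw [abs_of_nonneg hs] at hx₀
      have h1 := sub_le_integral_of_forall_ge hDm hη hT hh hm hc (x₀ := x₀) (ε := ε / 2)
        (fun s hs => by
          have := hlip x₀ s hs
          have h2 := monotone_cdf ρ (show x₀ ≤ x₀ + s by linarith)
          simp only [hDdef] at hx₀ ⊢
          linarith) hpos
      have h2 := (abs_le.1 (hsm (x₀ + h))).2
      linarith
    · rw [abs_of_nonpos hs] at hx₀
      have h1 := le_integral_of_forall_ge_neg hDm hη hT hh hm hc (x₀ := x₀) (ε := ε / 2)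
        (fun s hs => by
          have := hlip (x₀ - s) s hs
          rw [sub_add_cancel] at this
          have h2 := monotone_cdf ρ (show x₀ - s ≤ x₀ by linarith)
          simp only [hDdef] at hx₀ ⊢
          linarith) hpos
      have h2 := (abs_le.1 (hsm (x₀ - h))).1
      linarith
  linarith

end StepReinforced

namespace StepReinforced

open Real Set Filter Topology

/-! ### The standard normal distribution function -/

lemma cdf_gaussianReal_eq_integral (x : ℝ) :
    cdf (gaussianReal 0 1) x = ∫ s in Iic x, gaussianPDFReal 0 1 s := by
  rw [cdf_eq_real, measureReal_def, gaussianReal_apply_eq_integral 0 one_ne_zero,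
    ENNReal.toReal_ofReal (integral_nonneg fun s => gaussianPDFReal_nonneg _ _ _)]

lemma gaussianPDFReal_zero_one (x : ℝ) :
    gaussianPDFReal 0 1 x = (√(2 * π))⁻¹ * exp (-x ^ 2 / 2) := by
  simp [gaussianPDFReal_def]

lemma inv_sqrt_two_pi_le_one : (√(2 * π))⁻¹ ≤ 1 := by
  apply inv_le_one_of_one_le₀
  rw [one_le_sqrt]
  linarith [pi_gt_three]

lemma gaussianPDFReal_zero_one_le (x : ℝ) : gaussianPDFReal 0 1 x ≤ exp (-x ^ 2 / 2) := by
  rw [gaussianPDFReal_zero_one]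
  exact mul_le_of_le_one_left (exp_pos _).le inv_sqrt_two_pi_le_one

lemma continuous_gaussianPDFReal_zero_one : Continuous (gaussianPDFReal 0 1) := by
  rw [funext gaussianPDFReal_zero_one]
  fun_prop

lemma hasDerivAt_cdf_gaussianReal (x : ℝ) :
    HasDerivAt (cdf (gaussianReal 0 1)) (gaussianPDFReal 0 1 x) x := by
  have hi := integrable_gaussianPDFReal 0 1
  have h : (cdf (gaussianReal 0 1) : ℝ → ℝ) = fun x => cdf (gaussianReal 0 1) 0 +
      ∫ s in (0 : ℝ)..x, gaussianPDFReal 0 1 s := by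
    ext x
    rw [cdf_gaussianReal_eq_integral, cdf_gaussianReal_eq_integral,
      ← intervalIntegral.integral_Iic_sub_Iic hi.integrableOn hi.integrableOn]
    ring
  rw [h]
  refine HasDerivAt.const_add _ ?_
  exact intervalIntegral.integral_hasDerivAt_right hi.intervalIntegrable
    (continuous_gaussianPDFReal_zero_one.stronglyMeasurableAtFilter _ _)
    continuous_gaussianPDFReal_zero_one.continuousAt

lemma cdf_gaussianReal_add_le (x s : ℝ) (hs : 0 ≤ s) :
    cdf (gaussianReal 0 1) (x + s) ≤ cdf (gaussianReal 0 1) x + 1 * s := by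
  have := Convex.norm_image_sub_le_of_norm_hasDerivWithin_le (𝕜 := ℝ)
    (f := (cdf (gaussianReal 0 1) : ℝ → ℝ)) (f' := gaussianPDFReal 0 1) (C := 1) (s := univ)
    (x := x) (y := x + s) (fun y _ => (hasDerivAt_cdf_gaussianReal y).hasDerivWithinAt)
    (fun y _ => by
      rw [Real.norm_of_nonneg (gaussianPDFReal_nonneg _ _ _)]
      refine (gaussianPDFReal_zero_one_le y).trans (exp_le_one_iff.2 ?_)
      have := sq_nonneg y
      linarith)
    convex_univ (mem_univ _) (mem_univ _)
  rw [add_sub_cancel_left, Real.norm_eq_abs, Real.norm_eq_abs, abs_of_nonneg hs] at this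
  linarith [le_abs_self (cdf (gaussianReal 0 1) (x + s) - cdf (gaussianReal 0 1) x)]

/-! ### Characteristic functions of standardised laws -/

/-- Taylor's remainder handles |x| ≤ 1, and for |x| ≥ 1 every term is at most a multiple of |x|³.
The bound is global in x, so it can be integrated under a third moment alone. -/
lemma norm_exp_mul_I_sub_le (x : ℝ) :
    ‖Complex.exp (x * Complex.I) - (1 + x * Complex.I - x ^ 2 / 2)‖ ≤ 4 * |x| ^ 3 := by
  have hn : ‖(x : ℂ) * Complex.I‖ = |x| := by simp
  rcases le_total |x| 1 with hx | hx
  · have h := Complex.exp_bound (x := x * Complex.I) (by rwa [hn]) (n := 3) (by norm_num)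
    rw [hn] at h
    have hs : ∑ m ∈ Finset.range 3, ((x : ℂ) * Complex.I) ^ m / (m.factorial : ℂ) =
        1 + x * Complex.I - x ^ 2 / 2 := by
      simp [Finset.sum_range_succ, mul_pow]
      ring
    rw [hs] at h
    refine h.trans ?_
    have : (0 : ℝ) ≤ |x| ^ 3 := by positivity
    norm_num [Nat.factorial]
    linarith
  · have h1 : ‖Complex.exp (x * Complex.I)‖ = 1 := Complex.norm_exp_ofReal_mul_I x
    have h2 : ‖(x : ℂ) ^ 2 / 2‖ = |x| ^ 2 / 2 := by simp
    calc _ ≤ ‖Complex.exp (x * Complex.I)‖ + ((‖(1 : ℂ)‖ + ‖(x : ℂ) * Complex.I‖) +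
          ‖(x : ℂ) ^ 2 / 2‖) := by
          refine (norm_sub_le _ _).trans ?_
          gcongr
          refine (norm_sub_le _ _).trans ?_
          gcongr
          exact norm_add_le _ _
      _ = 2 + |x| + |x| ^ 2 / 2 := by rw [h1, h2, hn, norm_one]; ring
      _ ≤ 4 * |x| ^ 3 := by
          have h3 : |x| ^ 2 ≤ |x| ^ 3 := pow_le_pow_right₀ hx (by norm_num)
          have h4 : |x| ≤ |x| ^ 3 := by simpa using pow_le_pow_right₀ hx (show 1 ≤ 3 by norm_num)
          linarith

section Standardised

variable {μ : Measure ℝ} [IsProbabilityMeasure μ]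

lemma integrable_id_of_third_moment (hμ : Integrable (fun x : ℝ => |x| ^ 3) μ) :
    Integrable (fun x : ℝ => x) μ := by
  refine ((integrable_const (1 : ℝ)).add hμ).mono' (by fun_prop) (Eventually.of_forall fun x => ?_)
  simp only [Real.norm_eq_abs, Pi.add_apply]
  rcases le_total |x| 1 with h | h
  · have : (0 : ℝ) ≤ |x| ^ 3 := by positivity
    linarith
  · have h4 : |x| ≤ |x| ^ 3 := by simpa using pow_le_pow_right₀ h (show 1 ≤ 3 by norm_num)
    linarith

lemma integrable_sq_of_third_moment (hμ : Integrable (fun x : ℝ => |x| ^ 3) μ) :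
    Integrable (fun x : ℝ => x ^ 2) μ := by
  refine ((integrable_const (1 : ℝ)).add hμ).mono' (by fun_prop) (Eventually.of_forall fun x => ?_)
  simp only [norm_pow, Real.norm_eq_abs, Pi.add_apply]
  rcases le_total |x| 1 with h | h
  · have h3 : (0 : ℝ) ≤ |x| ^ 3 := by positivity
    have h2 : |x| ^ 2 ≤ 1 := pow_le_one₀ (abs_nonneg x) h
    linarith
  · have h4 : |x| ^ 2 ≤ |x| ^ 3 := pow_le_pow_right₀ h (by norm_num)
    linarith

/-- The polynomial 1 + 2y³ - 3y² = (y - 1)² (1 + 2y) is nonnegative for y ≥ 0. -/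
lemma one_le_third_moment (hμ : Integrable (fun x : ℝ => |x| ^ 3) μ) (h2 : ∫ x, x ^ 2 ∂μ = 1) :
    1 ≤ ∫ x, |x| ^ 3 ∂μ := by
  have h : ∫ x, 3 * x ^ 2 ∂μ ≤ ∫ x, (1 + 2 * |x| ^ 3) ∂μ := by
    refine integral_mono ((integrable_sq_of_third_moment hμ).const_mul 3)
      ((integrable_const 1).add (hμ.const_mul 2)) fun x => ?_
    change 3 * x ^ 2 ≤ 1 + 2 * |x| ^ 3
    rw [← sq_abs x]
    nlinarith [mul_nonneg (sq_nonneg (|x| - 1)) (show (0 : ℝ) ≤ 1 + 2 * |x| by positivity)]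
  rw [integral_add (integrable_const 1) (hμ.const_mul 2), integral_const_mul,
    integral_const_mul, h2] at h
  simp at h
  linarith

lemma norm_charFun_sub_le (hμ : Integrable (fun x : ℝ => |x| ^ 3) μ) (h1 : ∫ x, x ∂μ = 0)
    (h2 : ∫ x, x ^ 2 ∂μ = 1) (t : ℝ) :
    ‖charFun μ t - (1 - t ^ 2 / 2)‖ ≤ 4 * (∫ x, |x| ^ 3 ∂μ) * |t| ^ 3 := by
  have hi1 : Integrable (fun x : ℝ => (x : ℂ)) μ := (integrable_id_of_third_moment hμ).ofReal
  have hi2 : Integrable (fun x : ℝ => (x : ℂ) ^ 2) μ := by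
    have := (integrable_sq_of_third_moment hμ).ofReal (𝕜 := ℂ)
    simpa using this
  have hie : Integrable (fun x : ℝ => Complex.exp (t * x * Complex.I)) μ := by
    refine (integrable_const (1 : ℝ)).mono' (by fun_prop) (Eventually.of_forall fun x => ?_)
    rw [Complex.norm_exp]; simp
  have e1 : ∫ x : ℝ, (x : ℂ) ∂μ = 0 := by rw [integral_complex_ofReal, h1]; simp
  have e2 : ∫ x : ℝ, (x : ℂ) ^ 2 ∂μ = 1 := by
    have := integral_complex_ofReal (μ := μ) (f := fun x : ℝ => x ^ 2)
    rw [h2] at this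
    simpa using this
  have hip : Integrable (fun x : ℝ => (1 + (t * Complex.I) * x - (t : ℂ) ^ 2 / 2 * x ^ 2)) μ :=
    ((integrable_const _).add (hi1.const_mul _)).sub (hi2.const_mul _)
  have hpoly : ∫ x : ℝ, (1 + (t * Complex.I) * x - (t : ℂ) ^ 2 / 2 * x ^ 2) ∂μ =
      (1 : ℂ) - (t : ℂ) ^ 2 / 2 := by
    have hi3 : Integrable (fun x : ℝ => (1 + (t * Complex.I) * x : ℂ)) μ :=
      (integrable_const _).add (hi1.const_mul _)
    rw [integral_sub hi3 (hi2.const_mul _),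
      integral_add (integrable_const _) (hi1.const_mul _), integral_const_mul, integral_const_mul,
      e1, e2]
    simp
  rw [charFun_apply_real, ← hpoly, ← integral_sub hie hip]
  have hb : ∀ x : ℝ, ‖Complex.exp (t * x * Complex.I) -
      (1 + (t * Complex.I) * x - (t : ℂ) ^ 2 / 2 * x ^ 2)‖ ≤ 4 * |t| ^ 3 * |x| ^ 3 := by
    intro x
    have := norm_exp_mul_I_sub_le (t * x)
    rw [abs_mul, mul_pow, ← mul_assoc] at this
    convert this using 2
    push_cast
    ring
  refine (norm_integral_le_of_norm_le (hμ.const_mul (4 * |t| ^ 3))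
    (Eventually.of_forall hb)).trans ?_
  rw [integral_const_mul]
  exact le_of_eq (by ring)

/-- For small t this is the Taylor bound together with 1 + y ≤ exp y. For large t the exponent is
nonnegative because the third absolute moment is at least 1, so the trivial bound 1 suffices and no
restriction on t is needed. -/
lemma norm_charFun_le_exp (hμ : Integrable (fun x : ℝ => |x| ^ 3) μ) (h1 : ∫ x, x ∂μ = 0)
    (h2 : ∫ x, x ^ 2 ∂μ = 1) (t : ℝ) :
    ‖charFun μ t‖ ≤ exp (-t ^ 2 / 2 + 4 * (∫ x, |x| ^ 3 ∂μ) * |t| ^ 3) := by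
  have hβ := one_le_third_moment hμ h2
  set β := ∫ x, |x| ^ 3 ∂μ
  rcases le_total (t ^ 2 / 2) 1 with ht | ht
  · have h := norm_charFun_sub_le hμ h1 h2 t
    have hn : ‖(1 - (t : ℂ) ^ 2 / 2)‖ = 1 - t ^ 2 / 2 := by
      have : (1 - (t : ℂ) ^ 2 / 2) = ((1 - t ^ 2 / 2 : ℝ) : ℂ) := by push_cast; ring
      rw [this, Complex.norm_real, Real.norm_of_nonneg (by linarith)]
    have h3 := norm_le_norm_add_norm_sub (1 - (t : ℂ) ^ 2 / 2) (charFun μ t)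
    rw [hn, norm_sub_rev] at h3
    have := add_one_le_exp (-t ^ 2 / 2 + 4 * β * |t| ^ 3)
    linarith
  · refine (norm_charFun_le_one t).trans (one_le_exp ?_)
    have ht1 : 1 ≤ |t| := by
      by_contra hlt
      have : |t| ^ 2 < 1 := pow_lt_one₀ (abs_nonneg t) (not_le.1 hlt) two_ne_zero
      rw [sq_abs] at this
      linarith
    have h4 : |t| ^ 2 ≤ |t| ^ 3 := pow_le_pow_right₀ ht1 (by norm_num)
    rw [sq_abs] at h4
    nlinarith [sq_nonneg t]

lemma abs_exp_neg_sub_le (t : ℝ) : |exp (-t ^ 2 / 2) - (1 - t ^ 2 / 2)| ≤ |t| ^ 3 := by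
  rcases le_total |t| 1 with ht | ht
  · have h2 : |t| ^ 2 ≤ 1 := pow_le_one₀ (abs_nonneg t) ht
    have hu : |-t ^ 2 / 2| ≤ 1 := by
      rw [abs_div, abs_neg, abs_of_nonneg (sq_nonneg t), abs_two, ← sq_abs]; linarith
    have h := abs_exp_sub_one_sub_id_le hu
    rw [show exp (-t ^ 2 / 2) - (1 - t ^ 2 / 2) = exp (-t ^ 2 / 2) - 1 - -t ^ 2 / 2 by ring]
    refine h.trans ?_
    have : |t| ^ 4 ≤ |t| ^ 3 := pow_le_pow_of_le_one (abs_nonneg t) ht (by norm_num)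
    have h3 : (-t ^ 2 / 2) ^ 2 = |t| ^ 4 / 4 := by
      rw [show |t| ^ 4 = (|t| ^ 2) ^ 2 by ring, sq_abs]; ring
    have : 0 ≤ |t| ^ 4 := by positivity
    rw [h3]; linarith
  · have h1 := add_one_le_exp (-t ^ 2 / 2)
    have h2 : exp (-t ^ 2 / 2) ≤ 1 := exp_le_one_iff.2 (by linarith [sq_nonneg t])
    have h4 : |t| ^ 2 ≤ |t| ^ 3 := pow_le_pow_right₀ ht (by norm_num)
    rw [sq_abs] at h4
    rw [abs_of_nonneg (by linarith)]
    linarith [sq_nonneg t]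

lemma norm_charFun_sub_exp_le (hμ : Integrable (fun x : ℝ => |x| ^ 3) μ) (h1 : ∫ x, x ∂μ = 0)
    (h2 : ∫ x, x ^ 2 ∂μ = 1) (t : ℝ) :
    ‖charFun μ t - (exp (-t ^ 2 / 2) : ℝ)‖ ≤ 5 * (∫ x, |x| ^ 3 ∂μ) * |t| ^ 3 := by
  have hβ := one_le_third_moment hμ h2
  have h := norm_charFun_sub_le hμ h1 h2 t
  have h3 := abs_exp_neg_sub_le t
  have h4 : ‖(1 - (t : ℂ) ^ 2 / 2) - (exp (-t ^ 2 / 2) : ℝ)‖ ≤ |t| ^ 3 := by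
    rw [abs_sub_comm, ← Real.norm_eq_abs, ← Complex.norm_real] at h3
    simpa using h3
  have h5 := norm_sub_le_norm_sub_add_norm_sub (charFun μ t) (1 - (t : ℂ) ^ 2 / 2)
    ((exp (-t ^ 2 / 2) : ℝ) : ℂ)
  have : (0 : ℝ) ≤ |t| ^ 3 := by positivity
  nlinarith

end Standardised

/-! ### The Berry–Esseen theorem for weighted sums -/

/-- Telescoping, one factor replaced at a time. The majorants `c` are kept in place of 1 so that the
remaining factors still supply Gaussian decay. -/
lemma norm_prod_sub_prod_le {ι : Type*} [DecidableEq ι] (s : Finset ι) (a b : ι → ℂ) (c : ι → ℝ)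
    (ha : ∀ i ∈ s, ‖a i‖ ≤ c i) (hb : ∀ i ∈ s, ‖b i‖ ≤ c i) :
    ‖∏ i ∈ s, a i - ∏ i ∈ s, b i‖ ≤ ∑ i ∈ s, ‖a i - b i‖ * ∏ j ∈ s.erase i, c j := by
  induction s using Finset.induction_on with
  | empty => simp
  | insert k s hk ih =>
    rw [Finset.prod_insert hk, Finset.prod_insert hk, Finset.sum_insert hk,
      Finset.erase_insert hk]
    have hc : ∀ i ∈ insert k s, 0 ≤ c i := fun i hi => (norm_nonneg _).trans (ha i hi)
    have e : a k * ∏ i ∈ s, a i - b k * ∏ i ∈ s, b i =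
        (a k - b k) * ∏ i ∈ s, b i + a k * (∏ i ∈ s, a i - ∏ i ∈ s, b i) := by ring
    rw [e]
    refine (norm_add_le _ _).trans (add_le_add ?_ ?_)
    · rw [norm_mul, norm_prod]
      gcongr with i hi
      exact hb i (Finset.mem_insert_of_mem hi)
    · rw [norm_mul]
      refine (mul_le_mul (ha k (Finset.mem_insert_self _ _))
        (ih (fun i hi => ha i (Finset.mem_insert_of_mem hi))
          fun i hi => hb i (Finset.mem_insert_of_mem hi)) (norm_nonneg _)
        (hc k (Finset.mem_insert_self _ _))).trans ?_
      rw [Finset.mul_sum]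
      refine Finset.sum_le_sum fun i hi => ?_
      have hik : k ≠ i := fun h => hk (h ▸ hi)
      rw [Finset.erase_insert_of_ne hik, Finset.prod_insert (by simp [hk])]
      exact le_of_eq (by ring)

/-- `Γ` is the Lyapunov ratio. Dropping one factor loses at most a quarter of the variance, and in
the range 32 Γ |t| ≤ 1 the cubic correction is at most t²/8, so the exponent is at most -(3/4) t²/2
+ t²/8 = -t²/4. -/
lemma norm_prod_charFun_sub_le {μ : Measure ℝ} [IsProbabilityMeasure μ]
    (hμ : Integrable (fun x : ℝ => |x| ^ 3) μ) (h1 : ∫ x, x ∂μ = 0) (h2 : ∫ x, x ^ 2 ∂μ = 1)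
    {ι : Type*} (s : Finset ι) (w : ι → ℝ) (hw : ∑ i ∈ s, w i ^ 2 = 1) {Γ : ℝ}
    (hΓ : Γ = (∫ x, |x| ^ 3 ∂μ) * ∑ i ∈ s, |w i| ^ 3) (hΓ8 : Γ ≤ 1 / 8) {t : ℝ}
    (ht : 32 * Γ * |t| ≤ 1) :
    ‖∏ i ∈ s, charFun μ (w i * t) - (exp (-t ^ 2 / 2) : ℝ)‖ ≤
      5 * Γ * |t| ^ 3 * exp (-t ^ 2 / 4) := by
  classical
  have hβ := one_le_third_moment hμ h2
  set β := ∫ x, |x| ^ 3 ∂μ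
  have hΓ0 : 0 ≤ Γ := by rw [hΓ]; positivity
  have hexp : ((exp (-t ^ 2 / 2) : ℝ) : ℂ) = ∏ i ∈ s, ((exp (-(w i * t) ^ 2 / 2) : ℝ) : ℂ) := by
    rw [← Complex.ofReal_prod, ← exp_sum]
    congr 2
    rw [← Finset.sum_div, Finset.sum_neg_distrib]
    simp_rw [mul_pow]
    rw [← Finset.sum_mul, hw, one_mul]
  rw [hexp]
  refine (norm_prod_sub_prod_le s _ _
    (fun i => exp (-(w i * t) ^ 2 / 2 + 4 * β * |w i * t| ^ 3))
    (fun i _ => norm_charFun_le_exp hμ h1 h2 _) (fun i _ => ?_)).trans ?_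
  · rw [Complex.norm_real, Real.norm_of_nonneg (exp_pos _).le]
    apply exp_le_exp.2
    have : 0 ≤ 4 * β * |w i * t| ^ 3 := by positivity
    linarith
  have hprod : ∀ i ∈ s, ∏ j ∈ s.erase i, exp (-(w j * t) ^ 2 / 2 + 4 * β * |w j * t| ^ 3) ≤
      exp (-t ^ 2 / 4) := by
    intro i hi
    rw [← exp_sum]
    apply exp_le_exp.2
    rw [Finset.sum_add_distrib]
    have e1 : ∑ j ∈ s.erase i, -(w j * t) ^ 2 / 2 = -(1 - w i ^ 2) * t ^ 2 / 2 := by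
      have := Finset.sum_erase_add s (fun j => w j ^ 2) hi
      rw [hw] at this
      rw [← this, ← Finset.sum_div, Finset.sum_neg_distrib]
      simp_rw [mul_pow]
      rw [← Finset.sum_mul]
      ring
    have e2 : ∑ j ∈ s.erase i, 4 * β * |w j * t| ^ 3 ≤ 4 * Γ * |t| ^ 3 := by
      calc _ ≤ ∑ j ∈ s, 4 * β * |w j * t| ^ 3 :=
            Finset.sum_le_sum_of_subset_of_nonneg (Finset.erase_subset _ _)
              fun j _ _ => by positivity
        _ = _ := by
            simp_rw [abs_mul, mul_pow]
            rw [hΓ, ← Finset.mul_sum, ← Finset.sum_mul]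
            ring
    -- As the third moment is at least 1, |w i|³ ≤ Γ ≤ 1/8.
    have e3 : w i ^ 2 ≤ 1 / 4 := by
      have h3 : |w i| ^ 3 ≤ 1 / 8 := by
        have : |w i| ^ 3 ≤ ∑ j ∈ s, |w j| ^ 3 :=
          Finset.single_le_sum (f := fun j => |w j| ^ 3) (fun j _ => by positivity) hi
        have h0 : 0 ≤ ∑ j ∈ s, |w j| ^ 3 := by positivity
        nlinarith
      have h4 : |w i| ≤ 1 / 2 := by
        by_contra hlt
        have := pow_lt_pow_left₀ (not_le.1 hlt) (by norm_num) (three_ne_zero)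
        norm_num at this
        linarith
      rw [← sq_abs]
      nlinarith [abs_nonneg (w i)]
    have e4 : 4 * Γ * |t| ^ 3 ≤ t ^ 2 / 8 := by
      rw [← sq_abs t]
      nlinarith [sq_nonneg |t|]
    rw [e1]
    nlinarith [sq_nonneg t]
  calc ∑ i ∈ s, ‖charFun μ (w i * t) - ((exp (-(w i * t) ^ 2 / 2) : ℝ) : ℂ)‖ *
        ∏ j ∈ s.erase i, exp (-(w j * t) ^ 2 / 2 + 4 * β * |w j * t| ^ 3)
      ≤ ∑ i ∈ s, 5 * β * |w i * t| ^ 3 * exp (-t ^ 2 / 4) := by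
        refine Finset.sum_le_sum fun i hi => ?_
        exact mul_le_mul (norm_charFun_sub_exp_le hμ h1 h2 _) (hprod i hi)
          (Finset.prod_nonneg fun j _ => (exp_pos _).le) (by positivity)
    _ = _ := by
        simp_rw [abs_mul, mul_pow]
        rw [hΓ, ← Finset.sum_mul, ← Finset.mul_sum, ← Finset.sum_mul]
        ring

/-- Replaces the Gaussian by a majorant whose primitive is explicit (arctan). -/
lemma sq_mul_exp_neg_le (s : ℝ) : s ^ 2 * exp (-s ^ 2 / 4) ≤ 32 * (1 + s ^ 2)⁻¹ := by
  have h := quadratic_le_exp_of_nonneg (show 0 ≤ s ^ 2 / 4 by positivity)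
  rw [neg_div, exp_neg, ← div_eq_mul_inv, ← div_eq_mul_inv,
    div_le_div_iff₀ (exp_pos _) (by positivity)]
  nlinarith [sq_nonneg s, sq_nonneg (s ^ 2)]

/-- A measure whose characteristic function is the product of the characteristic functions of
rescaled copies of a standardised law is close to the standard normal law. -/
theorem exists_berry_esseen_of_charFun : ∃ C : ℝ, 0 < C ∧
    ∀ (μ : Measure ℝ) [IsProbabilityMeasure μ], Integrable (fun x : ℝ => |x| ^ 3) μ →
      ∫ x, x ∂μ = 0 → ∫ x, x ^ 2 ∂μ = 1 →
      ∀ (s : Finset ℕ) (w : ℕ → ℝ), ∑ i ∈ s, w i ^ 2 = 1 →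
      ∀ (ρ : Measure ℝ) [IsProbabilityMeasure ρ], Integrable id ρ →
      (∀ t, charFun ρ t = ∏ i ∈ s, charFun μ (w i * t)) →
      ∀ x, |cdf ρ x - cdf (gaussianReal 0 1) x| ≤
        C * ((∫ x, |x| ^ 3 ∂μ) * ∑ i ∈ s, |w i| ^ 3) := by
  obtain ⟨A, B, hA, hB, hAB⟩ := exists_smoothing_bound
  -- For Γ > 1/8 the trivial bound 1 ≤ 8 Γ applies. Otherwise T = 1 / (32 Γ): the integral of `g` is
  -- at most 160 Γ · 2, and 1/T = 32 Γ multiplies B.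
  refine ⟨320 * A + 32 * B + 8, by positivity, ?_⟩
  intro μ _ hμ h1 h2 s w hw ρ _ hρ hchar x
  have hβ := one_le_third_moment hμ h2
  obtain ⟨Γ, hΓ⟩ : ∃ Γ, Γ = (∫ x, |x| ^ 3 ∂μ) * ∑ i ∈ s, |w i| ^ 3 := ⟨_, rfl⟩
  rw [← hΓ]
  have hS : 0 < ∑ i ∈ s, |w i| ^ 3 := by
    refine lt_of_le_of_ne (by positivity) fun h0 => ?_
    have h3 := (Finset.sum_eq_zero_iff_of_nonneg (fun i _ => by positivity)).1 h0.symm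
    have : ∑ i ∈ s, w i ^ 2 = 0 := Finset.sum_eq_zero fun i hi => by
      have := h3 i hi
      simpa using this
    linarith
  have hΓ0 : 0 < Γ := by rw [hΓ]; positivity
  rcases lt_or_ge (1 / 8) Γ with h8 | h8
  · have h3 := cdf_nonneg ρ x; have h4 := cdf_le_one ρ x
    have h5 := cdf_nonneg (gaussianReal 0 1) x; have h6 := cdf_le_one (gaussianReal 0 1) x
    have : |cdf ρ x - cdf (gaussianReal 0 1) x| ≤ 1 := by
      rw [abs_le]; constructor <;> linarith
    have : 0 ≤ (320 * A + 32 * B) * Γ := by positivity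
    nlinarith
  · set T := 1 / (32 * Γ) with hT
    have hT0 : 0 < T := by positivity
    have hgauss : Integrable id (gaussianReal 0 1) := by
      have := memLp_id_gaussianReal (μ := 0) (v := 1) 1
      exact memLp_one_iff_integrable.1 (by exact_mod_cast this)
    have hmain := hAB ρ (gaussianReal 0 1) hρ hgauss 1 zero_le_one cdf_gaussianReal_add_le T hT0
      (fun t => 160 * Γ * (T * (1 + (t * T) ^ 2)⁻¹))
      (by
        apply Continuous.intervalIntegrable
        have : ∀ t : ℝ, 1 + (t * T) ^ 2 ≠ 0 := fun t => by positivity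
        fun_prop (disch := assumption)) ?_ x
    · refine hmain.trans ?_
      rw [intervalIntegral.integral_const_mul, intervalIntegral.integral_const_mul,
        intervalIntegral.mul_integral_comp_mul_right (f := fun x => (1 + x ^ 2)⁻¹) T,
        integral_inv_one_add_sq]
      have h3 : arctan (1 * T) - arctan (0 * T) ≤ 2 := by
        have := arctan_lt_pi_div_two (1 * T)
        have := pi_lt_four
        simp only [zero_mul, arctan_zero]
        linarith
      have h4 : (1 : ℝ) / T = 32 * Γ := by rw [hT, one_div_one_div]
      rw [h4]
      have : A * (160 * Γ * (arctan (1 * T) - arctan (0 * T))) ≤ A * (160 * Γ * 2) := by gcongr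
      nlinarith
    · intro t ht
      have ht0 := ht.1
      have hg : charFun (gaussianReal 0 1) (t * T) = (exp (-(t * T) ^ 2 / 2) : ℝ) := by
        rw [charFun_gaussianReal]
        push_cast
        congr 1
        simp
        ring
      have habs : |t * T| = t * T := abs_of_pos (by positivity)
      rw [hchar, hg, div_le_iff₀ ht0]
      refine (norm_prod_charFun_sub_le hμ h1 h2 s w hw hΓ h8 (t := t * T) ?_).trans ?_
      · rw [habs, hT]
        field_simp
        linarith [ht.2]
      · rw [habs]
        have := sq_mul_exp_neg_le (t * T)
        have h3 : 5 * Γ * (t * T) * ((t * T) ^ 2 * exp (-(t * T) ^ 2 / 4)) ≤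
          5 * Γ * (t * T) * (32 * (1 + (t * T) ^ 2)⁻¹) := by gcongr
        calc _ = 5 * Γ * (t * T) * ((t * T) ^ 2 * exp (-(t * T) ^ 2 / 4)) := by ring
          _ ≤ _ := h3
          _ = _ := by ring

/-- **Berry–Esseen bound** for weighted sums of i.i.d. variables with finite third moment. -/
theorem exists_berry_esseen_weighted (μ : Measure ℝ) [IsProbabilityMeasure μ]
    (hμ : Integrable (fun x : ℝ => |x| ^ 3) μ) (hσ : 0 < Var[id; μ]) :
    ∃ C : ℝ, 0 < C ∧ ∀ (Ω : Type*) [MeasurableSpace Ω] (P : Measure Ω) [IsProbabilityMeasure P]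
      (X : ℕ → Ω → ℝ), (∀ n, Measurable (X n)) → (∀ n, P.map (X n) = μ) → iIndepFun X P →
      ∀ (s : Finset ℕ) (w : ℕ → ℝ) (V : ℝ), V = ∑ i ∈ s, w i ^ 2 → 0 < V → ∀ y : ℝ,
      |P.real {ω | ∑ i ∈ s, w i * (X i ω - ∫ x, x ∂μ) ≤ √(Var[id; μ]) * √V * y} -
        cdf (gaussianReal 0 1) y| ≤ C * ((∑ i ∈ s, |w i| ^ 3) / (V * √V)) := by
  obtain ⟨C, hC, h⟩ := exists_berry_esseen_of_charFun
  set m := ∫ x, x ∂μ with hm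
  set σ := √(Var[id; μ]) with hσd
  have hσ0 : 0 < σ := sqrt_pos.2 hσ
  set ψ : ℝ → ℝ := fun x => (x - m) / σ with hψ
  have hψm : Measurable ψ := by fun_prop
  set μ₀ := μ.map ψ with hμ₀
  have : IsProbabilityMeasure μ₀ := Measure.isProbabilityMeasure_map hψm.aemeasurable
  have hid := integrable_id_of_third_moment hμ
  have hsq := integrable_sq_of_third_moment hμ
  have hcube : Integrable (fun x : ℝ => |x - m| ^ 3) μ := by
    refine (((integrable_const (4 * |m| ^ 3)).add (hμ.const_mul 4))).mono' (by fun_prop)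
      (Eventually.of_forall fun x => ?_)
    simp only [norm_pow, Real.norm_eq_abs, abs_abs, Pi.add_apply]
    have h1 : |x - m| ≤ |x| + |m| := abs_sub x m
    have h2 : |x - m| ^ 3 ≤ (|x| + |m|) ^ 3 := pow_le_pow_left₀ (abs_nonneg _) h1 3
    -- 4 (a³ + b³) - (a + b)³ = 3 (a + b) (a - b)².
    have h3 : 0 ≤ (|x| + |m|) * (|x| - |m|) ^ 2 := by positivity
    nlinarith
  have h0 : Integrable (fun x : ℝ => |x| ^ 3) μ₀ := by
    rw [hμ₀, integrable_map_measure (by fun_prop) hψm.aemeasurable]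
    refine (hcube.div_const (σ ^ 3)).congr (Eventually.of_forall fun x => ?_)
    simp only [Function.comp, hψ, abs_div, abs_of_pos hσ0, div_pow]
  have h1 : ∫ x, x ∂μ₀ = 0 := by
    rw [hμ₀, integral_map hψm.aemeasurable (by fun_prop)]
    simp only [hψ]
    rw [integral_div, integral_sub hid (integrable_const _)]
    simp [hm]
  have h2 : ∫ x, x ^ 2 ∂μ₀ = 1 := by
    rw [hμ₀, integral_map hψm.aemeasurable (by fun_prop)]
    simp only [hψ, div_pow]
    have hv := variance_eq_integral (μ := μ) (X := id) aemeasurable_id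
    simp only [id] at hv
    rw [integral_div, hσd, sq_sqrt hσ.le, ← hv]
    exact div_self hσ.ne'
  have hβ := one_le_third_moment h0 h2
  set β := ∫ x, |x| ^ 3 ∂μ₀
  refine ⟨C * β, by positivity, ?_⟩
  intro Ω _ P _ X hXm hXl hXi s w V hV hV0 y
  have hsV : 0 < √V := sqrt_pos.2 hV0
  have hYm : ∀ n, Measurable fun ω => ψ (X n ω) := fun n => hψm.comp (hXm n)
  have hYl : ∀ n, P.map (fun ω => ψ (X n ω)) = μ₀ := fun n => by
    rw [hμ₀, ← hXl n, Measure.map_map hψm (hXm n)]; rfl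
  set W : Ω → ℝ := fun ω => ∑ i ∈ s, w i / √V * ψ (X i ω) with hW
  have hWm : Measurable W := by
    refine Finset.measurable_fun_sum _ fun i _ => ?_
    exact (hYm i).const_mul _
  have : IsProbabilityMeasure (P.map W) := Measure.isProbabilityMeasure_map hWm.aemeasurable
  have hYint : ∀ n, Integrable (fun ω => ψ (X n ω)) P := fun n => by
    have := (integrable_map_measure (f := fun ω => ψ (X n ω)) (g := fun x : ℝ => x)
      (by fun_prop) (hYm n).aemeasurable).1 (by rw [hYl n]; exact integrable_id_of_third_moment h0)
    exact this
  have hWint : Integrable id (P.map W) := by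
    rw [integrable_map_measure (by fun_prop) hWm.aemeasurable]
    exact integrable_finsetSum _ fun i _ => (hYint i).const_mul _
  have hchar : ∀ t, charFun (P.map W) t = ∏ i ∈ s, charFun μ₀ (w i / √V * t) := by
    intro t
    have hind : iIndepFun (fun i ω => w i / √V * ψ (X i ω)) P :=
      hXi.comp (fun i x => w i / √V * ψ x) fun i => by fun_prop
    have := congrFun (iIndepFun.charFun_map_fun_finsetSum_eq_prod (s := s)
      (X := fun i ω => w i / √V * ψ (X i ω)) (P := P)
      (fun i _ => ((hYm i).const_mul _).aemeasurable)
      (iIndepFun_iff_finset.1 hind s)) t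
    rw [hW, this, Finset.prod_apply]
    refine Finset.prod_congr rfl fun i _ => ?_
    rw [charFun_map_mul_comp (hYm i).aemeasurable, hYl]
  have hw1 : ∑ i ∈ s, (w i / √V) ^ 2 = 1 := by
    simp_rw [div_pow, sq_sqrt hV0.le]
    rw [← Finset.sum_div, ← hV, div_self hV0.ne']
  have hmain := h μ₀ h0 h1 h2 s (fun i => w i / √V) hw1 (P.map W) hWint hchar y
  have hset : {ω | ∑ i ∈ s, w i * (X i ω - m) ≤ σ * √V * y} = W ⁻¹' Iic y := by
    ext ω
    simp only [mem_preimage, mem_Iic, hW, hψ, mem_ofPred_eq]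
    have : ∑ i ∈ s, w i / √V * ((X i ω - m) / σ) = (∑ i ∈ s, w i * (X i ω - m)) / (σ * √V) := by
      rw [Finset.sum_div]
      refine Finset.sum_congr rfl fun i _ => ?_
      field_simp
    rw [this, div_le_iff₀ (by positivity), mul_comm y]
  have hcdf : P.real {ω | ∑ i ∈ s, w i * (X i ω - m) ≤ σ * √V * y} = cdf (P.map W) y := by
    rw [cdf_eq_real, map_measureReal_apply hWm measurableSet_Iic, hset]
  rw [hcdf]
  refine hmain.trans (le_of_eq ?_)
  have : ∑ i ∈ s, |w i / √V| ^ 3 = (∑ i ∈ s, |w i| ^ 3) / (V * √V) := by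
    rw [Finset.sum_div]
    refine Finset.sum_congr rfl fun i _ => ?_
    rw [abs_div, abs_of_pos hsV, div_pow]
    congr 1
    rw [pow_succ, sq_sqrt hV0.le]
  rw [this]
  ring

end StepReinforced

namespace StepReinforced

open Real Set Filter Topology

/-! ### Expansion of the normal distribution function in the variance -/

lemma abs_mul_exp_neg_sq_le (z : ℝ) : |z| * exp (-z ^ 2 / 2) ≤ 1 := by
  have h := quadratic_le_exp_of_nonneg (show 0 ≤ z ^ 2 / 2 by positivity)
  rw [neg_div, exp_neg, ← div_eq_mul_inv, div_le_one (exp_pos _)]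
  rw [← sq_abs] at h ⊢
  nlinarith [sq_nonneg (|z| - 1), sq_nonneg (|z| ^ 2)]

lemma abs_pow_three_mul_exp_neg_sq_le (z : ℝ) : |z| ^ 3 * exp (-z ^ 2 / 2) ≤ 2 := by
  have h := quadratic_le_exp_of_nonneg (show 0 ≤ z ^ 2 / 2 by positivity)
  rw [neg_div, exp_neg, ← div_eq_mul_inv, div_le_iff₀ (exp_pos _)]
  rw [← sq_abs] at h ⊢
  nlinarith [sq_nonneg (|z| * (|z| - 2)), abs_nonneg z]

lemma abs_mul_gaussianPDFReal_le (z : ℝ) : |z * gaussianPDFReal 0 1 z| ≤ 1 := by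
  rw [abs_mul, abs_of_nonneg (gaussianPDFReal_nonneg _ _ _)]
  exact (mul_le_mul_of_nonneg_left (gaussianPDFReal_zero_one_le z) (abs_nonneg z)).trans
    (abs_mul_exp_neg_sq_le z)

lemma abs_pow_three_mul_gaussianPDFReal_le (z : ℝ) : |z| ^ 3 * gaussianPDFReal 0 1 z ≤ 2 :=
  (mul_le_mul_of_nonneg_left (gaussianPDFReal_zero_one_le z) (by positivity)).trans
    (abs_pow_three_mul_exp_neg_sq_le z)

lemma hasDerivAt_gaussianPDFReal (z : ℝ) :
    HasDerivAt (gaussianPDFReal 0 1) (-z * gaussianPDFReal 0 1 z) z := by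
  rw [funext gaussianPDFReal_zero_one]
  have h1 : HasDerivAt (fun z : ℝ => -z ^ 2 / 2) (-z) z := by
    convert! (((hasDerivAt_id z).pow 2).neg.div_const 2) using 1
    simp only [id_eq]
    ring
  convert! (h1.exp.const_mul (√(2 * π))⁻¹) using 1
  ring

lemma hasDerivAt_div_sqrt (x : ℝ) {r : ℝ} (hr : -1 < r) :
    HasDerivAt (fun r => x / √(1 + r)) (-(x / √(1 + r)) / (2 * (1 + r))) r := by
  have h0 : 0 < 1 + r := by linarith
  have h1 : HasDerivAt (fun r : ℝ => √(1 + r)) (1 / (2 * √(1 + r))) r :=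
    ((hasDerivAt_id r).const_add 1).sqrt h0.ne'
  have hs : √(1 + r) ≠ 0 := (sqrt_pos.2 h0).ne'
  have h2 : √(1 + r) ^ 2 = 1 + r := sq_sqrt h0.le
  convert! (h1.inv hs).const_mul x using 1
  rw [h2]
  field_simp

/-- Mean value inequality in r. With z = x / √(1 + r) and φ the normal density, z φ(z) and z³ φ(z)
are bounded by 1 and 2, so the derivative is at most 5/2 divided by (1 + r)² ≥ 1/4, uniformly in x.
-/
lemma abs_gaussian_slope_sub_le (x : ℝ) {r : ℝ} (hr : -(1 / 2) ≤ r) :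
    |x / √(1 + r) * gaussianPDFReal 0 1 (x / √(1 + r)) / (1 + r) - x * gaussianPDFReal 0 1 x|
      ≤ 10 * |r| := by
  have hd : ∀ s ∈ Ici (-(1 / 2) : ℝ), HasDerivWithinAt
      (fun r => x / √(1 + r) * gaussianPDFReal 0 1 (x / √(1 + r)) / (1 + r))
      ((-((x / √(1 + s)) - (x / √(1 + s)) ^ 3) / 2 - x / √(1 + s)) *
        gaussianPDFReal 0 1 (x / √(1 + s)) / (1 + s) ^ 2) (Ici (-(1 / 2) : ℝ)) s := by
    intro s hs
    have hs' : (-(1 / 2) : ℝ) ≤ s := hs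
    have h0 : 0 < 1 + s := by linarith
    have h1 := hasDerivAt_div_sqrt x (r := s) (by linarith)
    have h2 := (hasDerivAt_gaussianPDFReal (x / √(1 + s))).comp s h1
    have h3 : HasDerivAt (fun r : ℝ => 1 + r) 1 s := (hasDerivAt_id s).const_add 1
    refine HasDerivAt.hasDerivWithinAt ?_
    convert! (h1.mul h2).div h3 h0.ne' using 1
    simp only [Function.comp, Pi.mul_apply]
    field_simp
    ring
  have hb : ∀ s ∈ Ici (-(1 / 2) : ℝ), ‖(-((x / √(1 + s)) - (x / √(1 + s)) ^ 3) / 2 -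
      x / √(1 + s)) * gaussianPDFReal 0 1 (x / √(1 + s)) / (1 + s) ^ 2‖ ≤ 10 := by
    intro s hs
    have hs' : (-(1 / 2) : ℝ) ≤ s := hs
    have h0 : 0 < (1 + s) ^ 2 := by have : 0 < 1 + s := by linarith
                                    positivity
    set z := x / √(1 + s)
    have e1 := abs_mul_gaussianPDFReal_le z
    have e2 := abs_pow_three_mul_gaussianPDFReal_le z
    have hg := gaussianPDFReal_nonneg 0 1 z
    rw [← abs_pow, ← abs_of_nonneg hg, ← abs_mul] at e2
    rw [norm_div, Real.norm_eq_abs, Real.norm_eq_abs, abs_of_pos h0, div_le_iff₀ h0]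
    have h4 : (1 / 4 : ℝ) ≤ (1 + s) ^ 2 := by nlinarith
    rw [abs_le] at e1 e2 ⊢
    constructor <;> nlinarith
  have h := Convex.norm_image_sub_le_of_norm_hasDerivWithin_le (𝕜 := ℝ) hd hb (convex_Ici _)
    (x := 0) (y := r) (by simp) hr
  simpa using h

/-- For r ≥ -1/2 the derivative of the left side in r is half a slope difference, hence at most 5
|r|. For r < -1/2 the left side is at most 1 + |r|/2 ≤ 5 r². Allowing every r > -1 lets the bound be
integrated over all label configurations. -/
lemma abs_cdf_gaussianReal_div_sqrt_sub_le (x : ℝ) {r : ℝ} (hr : -1 < r) :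
    |cdf (gaussianReal 0 1) (x / √(1 + r)) - cdf (gaussianReal 0 1) x +
      x * gaussianPDFReal 0 1 x / 2 * r| ≤ 5 * r ^ 2 := by
  set ψ := x * gaussianPDFReal 0 1 x with hψ
  rcases lt_or_ge r (-(1 / 2)) with h | h
  · have h1 := cdf_nonneg (gaussianReal 0 1) x
    have h2 := cdf_le_one (gaussianReal 0 1) x
    have h3 := cdf_nonneg (gaussianReal 0 1) (x / √(1 + r))
    have h4 := cdf_le_one (gaussianReal 0 1) (x / √(1 + r))
    have h5 := abs_le.1 (abs_mul_gaussianPDFReal_le x)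
    rw [← hψ] at h5
    rw [abs_le]; constructor <;> nlinarith
  · have hd : ∀ s ∈ uIcc 0 r, HasDerivWithinAt
        (fun r => cdf (gaussianReal 0 1) (x / √(1 + r)) + ψ / 2 * r)
        (-(x / √(1 + s) * gaussianPDFReal 0 1 (x / √(1 + s)) / (1 + s) - ψ) / 2)
        (uIcc 0 r) s := by
      intro s hs
      have hs1 : -1 < s := by
        rcases mem_uIcc.1 hs with h' | h' <;> linarith [h'.1]
      have h0 : 0 < 1 + s := by linarith
      have h1 := (hasDerivAt_cdf_gaussianReal (x / √(1 + s))).comp s (hasDerivAt_div_sqrt x hs1)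
      refine HasDerivAt.hasDerivWithinAt ?_
      convert! h1.add ((hasDerivAt_id s).const_mul (ψ / 2)) using 1
      field_simp
      ring
    have hb : ∀ s ∈ uIcc 0 r,
        ‖-(x / √(1 + s) * gaussianPDFReal 0 1 (x / √(1 + s)) / (1 + s) - ψ) / 2‖ ≤ 5 * |r| := by
      intro s hs
      have hs1 : -(1 / 2) ≤ s := by
        rcases mem_uIcc.1 hs with h' | h' <;> linarith [h'.1]
      have hsr : |s| ≤ |r| := by
        have := abs_sub_left_of_mem_uIcc hs
        simpa using this
      have := abs_gaussian_slope_sub_le x hs1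
      rw [← hψ] at this
      rw [norm_div, norm_neg, Real.norm_eq_abs, Real.norm_eq_abs, abs_two]
      linarith
    have := Convex.norm_image_sub_le_of_norm_hasDerivWithin_le (𝕜 := ℝ) hd hb (convex_uIcc 0 r)
      (x := 0) (y := r) left_mem_uIcc right_mem_uIcc
    simp only [add_zero, sqrt_one, div_one, mul_zero, Real.norm_eq_abs, sub_zero] at this
    rw [mul_assoc, ← sq, sq_abs] at this
    convert this using 2
    ring

end StepReinforced

namespace StepReinforced

open Real Set Filter Topology

/-! ### Moment recursions -/

/-- The expectation of `∑ N_j²` at time `n + 1`, where `q = 1 - p`. -/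
noncomputable def sqMean (q : ℝ) : ℕ → ℝ
  | 0 => 1
  | n + 1 => (1 + 2 * q / (n + 1)) * sqMean q n + 1

/-- The expectation of `∑ N_j³` at time `n + 1`, where `q = 1 - p`. -/
noncomputable def cubeMean (q : ℝ) : ℕ → ℝ
  | 0 => 1
  | n + 1 => (1 + 3 * q / (n + 1)) * cubeMean q n + 3 * q / (n + 1) * sqMean q n + 1

/-- By Bernoulli's inequality (n + 1)^c is a supersolution of the homogeneous recursion, so x n / (n
+ 1)^c grows by at most f n / (n + 1)^c at each step. -/
lemma le_rpow_mul_of_recursion {x f : ℕ → ℝ} {a c : ℝ} (ha : 0 ≤ a) (hac : a ≤ c) (hc : 1 ≤ c)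
    (h0 : 0 ≤ x 0) (hf : ∀ n, 0 ≤ f n) (hx : ∀ n, x (n + 1) ≤ (1 + a / (n + 1)) * x n + f n)
    (n : ℕ) :
    x n ≤ ((n : ℝ) + 1) ^ c * (x 0 + ∑ k ∈ Finset.range n, f k / ((k : ℝ) + 1) ^ c) := by
  induction n with
  | zero => simp
  | succ n ih =>
    have hn : (0 : ℝ) < (n : ℝ) + 1 := by positivity
    have hS : 0 ≤ x 0 + ∑ k ∈ Finset.range n, f k / ((k : ℝ) + 1) ^ c :=
      add_nonneg h0 (Finset.sum_nonneg fun k _ => div_nonneg (hf k) (by positivity))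
    have hb : (1 + c / (n + 1)) * ((n : ℝ) + 1) ^ c ≤ ((n : ℝ) + 1 + 1) ^ c := by
      have h1 := one_add_mul_self_le_rpow_one_add
        (show (-1 : ℝ) ≤ 1 / (n + 1) by have : (0 : ℝ) < 1 / (n + 1) := by positivity
                                        linarith) hc
      have h2 : ((n : ℝ) + 1 + 1) = (1 + 1 / (n + 1)) * (n + 1) := by field_simp
      rw [h2, mul_rpow (by positivity) hn.le]
      have h3 : c / (n + 1) = c * (1 / (n + 1)) := by ring
      rw [h3]
      gcongr
    have hle : ((n : ℝ) + 1) ^ c ≤ ((n : ℝ) + 1 + 1) ^ c := by gcongr; linarith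
    have hf' : f n ≤ ((n : ℝ) + 1 + 1) ^ c * (f n / ((n : ℝ) + 1) ^ c) := by
      have hp : (0 : ℝ) < ((n : ℝ) + 1) ^ c := by positivity
      rw [mul_div_assoc', le_div_iff₀ hp, mul_comm]
      exact mul_le_mul_of_nonneg_right hle (hf n)
    rw [Finset.sum_range_succ, ← add_assoc, mul_add]
    push_cast
    refine (hx n).trans (add_le_add ?_ hf')
    calc (1 + a / (n + 1)) * x n
        ≤ (1 + a / (n + 1)) * (((n : ℝ) + 1) ^ c *
          (x 0 + ∑ k ∈ Finset.range n, f k / ((k : ℝ) + 1) ^ c)) := by gcongr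
      _ ≤ (1 + c / (n + 1)) * (((n : ℝ) + 1) ^ c *
          (x 0 + ∑ k ∈ Finset.range n, f k / ((k : ℝ) + 1) ^ c)) := by gcongr
      _ = (1 + c / (n + 1)) * ((n : ℝ) + 1) ^ c *
          (x 0 + ∑ k ∈ Finset.range n, f k / ((k : ℝ) + 1) ^ c) := by ring
      _ ≤ _ := by gcongr

lemma exists_sum_rpow_le {θ : ℝ} (hθ : θ < -1) :
    ∃ S : ℝ, 0 < S ∧ ∀ n : ℕ, ∑ k ∈ Finset.range n, ((k : ℝ) + 1) ^ θ ≤ S := by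
  have hs : Summable fun k : ℕ => ((k : ℝ) + 1) ^ θ := by
    have := (summable_nat_add_iff 1).2 (summable_nat_rpow.2 hθ)
    simpa using this
  refine ⟨∑' k : ℕ, ((k : ℝ) + 1) ^ θ + 1, ?_, fun n => ?_⟩
  · have : 0 ≤ ∑' k : ℕ, ((k : ℝ) + 1) ^ θ := tsum_nonneg fun k => by positivity
    linarith
  · have := hs.sum_le_tsum (Finset.range n) fun k _ => by positivity
    linarith

/-- Solutions of a recursion with multipliers `1 + a / n` grow at most like `n ^ c`, `c ≥ a`, if
the inhomogeneity is of order `n ^ θ` with `θ < c - 1`. -/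
lemma exists_rpow_bound_of_recursion {a c θ K x₀ : ℝ} (ha : 0 ≤ a) (hac : a ≤ c) (hc : 1 ≤ c)
    (hθ : θ < c - 1) (hx₀ : 0 ≤ x₀) (hK : 0 ≤ K) :
    ∃ M : ℝ, 0 < M ∧ ∀ x : ℕ → ℝ, x 0 = x₀ →
      (∀ n, x (n + 1) ≤ (1 + a / (n + 1)) * x n + K * ((n : ℝ) + 1) ^ θ) →
      ∀ n, x n ≤ M * ((n : ℝ) + 1) ^ c := by
  obtain ⟨S, hS, hSn⟩ := exists_sum_rpow_le (show θ - c < -1 by linarith)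
  refine ⟨x₀ + K * S + 1, by positivity, fun x h0 hx n => ?_⟩
  have h := le_rpow_mul_of_recursion ha hac hc (by rw [h0]; exact hx₀)
    (fun n => by positivity) hx n
  have hsum : ∑ k ∈ Finset.range n, K * ((k : ℝ) + 1) ^ θ / ((k : ℝ) + 1) ^ c ≤ K * S := by
    have : ∀ k ∈ Finset.range n, K * ((k : ℝ) + 1) ^ θ / ((k : ℝ) + 1) ^ c =
        K * ((k : ℝ) + 1) ^ (θ - c) := fun k _ => by
      rw [rpow_sub (by positivity), mul_div_assoc]
    rw [Finset.sum_congr rfl this, ← Finset.mul_sum]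
    exact mul_le_mul_of_nonneg_left (hSn n) hK
  refine h.trans ?_
  rw [h0, mul_comm]
  refine mul_le_mul_of_nonneg_right ?_ (by positivity)
  linarith

/-- K (n + 1) is a supersolution as soon as D ≤ K (1 - a). Unlike the power bound above, this loses
nothing in the exponent. -/
lemma exists_linear_bound_of_recursion {x : ℕ → ℝ} {a D : ℝ} (ha : 0 ≤ a) (ha1 : a < 1)
    (hD : 0 ≤ D) (hx : ∀ n, x (n + 1) ≤ (1 + a / (n + 1)) * x n + D) :
    ∃ K : ℝ, 0 < K ∧ ∀ n, x n ≤ K * ((n : ℝ) + 1) := by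
  have h1 : 0 < 1 - a := by linarith
  have hKD : D ≤ (|x 0| + D / (1 - a) + 1) * (1 - a) := by
    have : D / (1 - a) * (1 - a) = D := div_mul_cancel₀ _ h1.ne'
    nlinarith [abs_nonneg (x 0)]
  refine ⟨|x 0| + D / (1 - a) + 1, by positivity, fun n => ?_⟩
  set K := |x 0| + D / (1 - a) + 1 with hK
  induction n with
  | zero =>
    have : 0 ≤ D / (1 - a) := by positivity
    simp only [Nat.cast_zero, zero_add, mul_one, hK]
    linarith [le_abs_self (x 0)]
  | succ n ih =>
    have hn : (0 : ℝ) < (n : ℝ) + 1 := by positivity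
    calc x (n + 1) ≤ (1 + a / (n + 1)) * x n + D := hx n
      _ ≤ (1 + a / (n + 1)) * (K * (n + 1)) + D := by gcongr
      _ = K * (n + 1) + a * K + D := by field_simp
      _ ≤ K * (((n + 1 : ℕ) : ℝ) + 1) := by push_cast; nlinarith

/-! ### Growth of the moment sequences -/

section Bounds

variable {q : ℝ}

lemma sqMean_pos (hq : 0 < q) (n : ℕ) : 0 < sqMean q n := by
  induction n with
  | zero => simp [sqMean]
  | succ n ih => rw [sqMean]; positivity

/-- The slack η covers q = 1/2, where the true growth is n log n. -/
lemma exists_sqMean_le_rpow (hq : 0 < q) (hq2 : q ≤ 1 / 2) {η : ℝ} (hη : 0 < η) :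
    ∃ K : ℝ, 0 < K ∧ ∀ n, sqMean q n ≤ K * ((n : ℝ) + 1) ^ (1 + η) := by
  obtain ⟨M, hM, h⟩ := exists_rpow_bound_of_recursion (a := 2 * q) (c := 1 + η) (θ := 0) (K := 1)
    (x₀ := 1) (by positivity) (by linarith) (by linarith) (by linarith) zero_le_one zero_le_one
  exact ⟨M, hM, h (sqMean q) rfl fun n => by simp [sqMean]⟩

lemma exists_sqMean_le_linear (hq : 0 < q) (hq2 : q < 1 / 2) :
    ∃ K : ℝ, 0 < K ∧ ∀ n, sqMean q n ≤ K * ((n : ℝ) + 1) :=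
  exists_linear_bound_of_recursion (a := 2 * q) (D := 1) (by positivity) (by linarith) zero_le_one
    fun n => by rw [sqMean]

lemma cubeMean_succ_le {η K : ℝ} (hq : 0 < q) (hη : 0 ≤ η)
    (h : ∀ n, sqMean q n ≤ K * ((n : ℝ) + 1) ^ (1 + η)) (n : ℕ) :
    cubeMean q (n + 1) ≤ (1 + 3 * q / (n + 1)) * cubeMean q n +
      (3 * q * K + 1) * ((n : ℝ) + 1) ^ η := by
  have hn : (0 : ℝ) < (n : ℝ) + 1 := by positivity
  rw [cubeMean, add_assoc]
  gcongr
  have h1 : 3 * q / (n + 1) * sqMean q n ≤ 3 * q * K * ((n : ℝ) + 1) ^ η := by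
    calc 3 * q / (n + 1) * sqMean q n ≤ 3 * q / (n + 1) * (K * ((n : ℝ) + 1) ^ (1 + η)) := by
          gcongr; exact h n
      _ = _ := by rw [rpow_add hn, rpow_one]; field_simp
  have h2 : (1 : ℝ) ≤ ((n : ℝ) + 1) ^ η := one_le_rpow (by linarith [n.cast_nonneg (α := ℝ)]) hη
  linarith

lemma exists_cubeMean_le_rpow (hq : 0 < q) (hq2 : q ≤ 1 / 2) {c : ℝ} (hc : 1 < c)
    (hqc : 3 * q ≤ c) : ∃ K : ℝ, 0 < K ∧ ∀ n, cubeMean q n ≤ K * ((n : ℝ) + 1) ^ c := by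
  obtain ⟨K, hK, hv⟩ := exists_sqMean_le_rpow hq hq2 (show 0 < (c - 1) / 2 by linarith)
  obtain ⟨M, hM, h⟩ := exists_rpow_bound_of_recursion (a := 3 * q) (c := c) (θ := (c - 1) / 2)
    (K := 3 * q * K + 1) (x₀ := 1) (by positivity) hqc hc.le (by linarith) zero_le_one
    (by positivity)
  exact ⟨M, hM, h (cubeMean q) rfl fun n => cubeMean_succ_le hq (by linarith) hv n⟩

lemma cubeMean_succ_le_of_linear {K : ℝ} (hq : 0 < q)
    (h : ∀ n, sqMean q n ≤ K * ((n : ℝ) + 1)) (n : ℕ) :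
    cubeMean q (n + 1) ≤ (1 + 3 * q / (n + 1)) * cubeMean q n + (3 * q * K + 1) := by
  have := cubeMean_succ_le hq le_rfl (K := K) (by simpa using h) n
  simpa using this

lemma exists_cubeMean_le_linear (hq : 0 < q) (hq3 : q < 1 / 3) :
    ∃ K : ℝ, 0 < K ∧ ∀ n, cubeMean q n ≤ K * ((n : ℝ) + 1) := by
  obtain ⟨K, hK, h⟩ := exists_sqMean_le_linear hq (by linarith)
  exact exists_linear_bound_of_recursion (a := 3 * q) (D := 3 * q * K + 1) (by positivity)
    (by linarith) (by positivity) fun n => cubeMean_succ_le_of_linear hq h n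

/-- At q = 1/3 the multiplier 1 + 1/(n + 1) is in resonance with a bounded source, and the harmonic
sum produces the logarithm. The case n = 0 is excluded because log 1 = 0. -/
lemma exists_cubeMean_third_le :
    ∃ K : ℝ, 0 < K ∧ ∀ n : ℕ, 1 ≤ n → cubeMean (1 / 3) n ≤
      K * (((n : ℝ) + 1) * log ((n : ℝ) + 1)) := by
  obtain ⟨K, hK, hv⟩ := exists_sqMean_le_linear (q := 1 / 3) (by norm_num) (by norm_num)
  obtain ⟨D, hD⟩ : ∃ D, D = 3 * (1 / 3) * K + 1 := ⟨_, rfl⟩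
  have hD0 : 0 < D := by rw [hD]; positivity
  have hl2 : 0 < log 2 := log_pos one_lt_two
  refine ⟨(1 + D) / log 2 + D, by positivity, fun n hn => ?_⟩
  have h := le_rpow_mul_of_recursion (x := cubeMean (1 / 3)) (f := fun _ => D) (a := 3 * (1 / 3))
    (c := 1) (by norm_num) (by norm_num) le_rfl (by simp [cubeMean]) (fun _ => hD0.le)
    (fun n => by rw [hD]; exact cubeMean_succ_le_of_linear (by norm_num) hv n) n
  have hsum : ∑ k ∈ Finset.range n, D / ((k : ℝ) + 1) ^ (1 : ℝ) ≤ D * (1 + log (n + 1)) := by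
    have e : ∑ k ∈ Finset.range n, D / ((k : ℝ) + 1) ^ (1 : ℝ) = D * (harmonic n : ℝ) := by
      simp [harmonic, Finset.mul_sum, div_eq_mul_inv]
    rw [e]
    gcongr
    refine (harmonic_le_one_add_log n).trans ?_
    have : log (n : ℝ) ≤ log (n + 1) := log_le_log (by positivity) (by linarith)
    linarith
  have hn1 : (1 : ℝ) ≤ n := by exact_mod_cast hn
  have hlog : log 2 ≤ log ((n : ℝ) + 1) := log_le_log (by norm_num) (by linarith)
  have h1 : (1 + D) ≤ (1 + D) / log 2 * log ((n : ℝ) + 1) := by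
    rw [div_mul_eq_mul_div, le_div_iff₀ hl2]
    gcongr
  rw [rpow_one] at h
  refine h.trans ?_
  have h0 : cubeMean (1 / 3) 0 = 1 := rfl
  rw [h0]
  calc ((n : ℝ) + 1) * (1 + ∑ k ∈ Finset.range n, D / ((k : ℝ) + 1) ^ (1 : ℝ))
      ≤ ((n : ℝ) + 1) * (((1 + D) / log 2 + D) * log ((n : ℝ) + 1)) := by
        gcongr
        nlinarith
    _ = _ := by ring

/-- Growth of a sequence obeying the recursion for the variance of `∑ N_j²`. -/
lemma exists_variance_le_rpow (hq : 0 < q) {c d K : ℝ} (hc : 1 ≤ c) (hqc : 4 * q ≤ c)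
    (hd : d < c) (hK : 0 < K) (ht : ∀ n, cubeMean q n ≤ K * ((n : ℝ) + 1) ^ d) :
    ∃ M : ℝ, 0 < M ∧ ∀ x : ℕ → ℝ, x 0 = 0 →
      (∀ n, x (n + 1) ≤ (1 + 4 * q / (n + 1)) * x n + 4 * q / (n + 1) * cubeMean q n) →
      ∀ n, x n ≤ M * ((n : ℝ) + 1) ^ c := by
  obtain ⟨M, hM, h⟩ := exists_rpow_bound_of_recursion (a := 4 * q) (c := c) (θ := d - 1)
    (K := 4 * q * K) (x₀ := 0) (by positivity) hqc hc (by linarith) le_rfl (by positivity)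
  refine ⟨M, hM, fun x h0 hx n => h x h0 (fun n => (hx n).trans ?_) n⟩
  have hn : (0 : ℝ) < (n : ℝ) + 1 := by positivity
  refine add_le_add le_rfl ?_
  calc 4 * q / (n + 1) * cubeMean q n ≤ 4 * q / (n + 1) * (K * ((n : ℝ) + 1) ^ d) := by
        gcongr; exact ht n
    _ = _ := by rw [rpow_sub hn, rpow_one]; field_simp

end Bounds

/-! ### The variance sequence `b` -/

/-- Log-convexity of Γ, with m + a between m and m + 1. -/
lemma Gamma_add_le_rpow_mul {m a : ℝ} (hm : 0 < m) (ha : 0 < a) (ha1 : a < 1) :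
    Gamma (m + a) ≤ m ^ a * Gamma m := by
  have h := Gamma_mul_add_mul_le_rpow_Gamma_mul_rpow_Gamma hm (show 0 < m + 1 by linarith)
    (show 0 < 1 - a by linarith) ha (by ring)
  have hG := Gamma_pos_of_pos hm
  rw [show (1 - a) * m + a * (m + 1) = m + a by ring, Gamma_add_one hm.ne',
    mul_rpow hm.le hG.le, mul_left_comm, ← rpow_add hG] at h
  simpa using h

/-- Log-convexity again, with m + 1 between m + a and m + a + 1. -/
lemma mul_Gamma_le_rpow_mul {m a : ℝ} (hm : 0 < m) (ha : 0 < a) (ha1 : a < 1) :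
    m * Gamma m ≤ (m + a) ^ (1 - a) * Gamma (m + a) := by
  have hma : 0 < m + a := by linarith
  have h := Gamma_mul_add_mul_le_rpow_Gamma_mul_rpow_Gamma hma
    (show 0 < m + a + 1 by linarith) ha (show 0 < 1 - a by linarith) (by ring)
  have hG := Gamma_pos_of_pos hma
  rw [show a * (m + a) + (1 - a) * (m + a + 1) = m + 1 by ring, Gamma_add_one hm.ne',
    Gamma_add_one hma.ne', mul_rpow hma.le hG.le, mul_left_comm, ← rpow_add hG] at h
  simpa using h

/-- The two convexity bounds trap the ratio between m^a · m/(m + a) and m^a, an interval of length a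
m^a / (m + a) ≤ 1. -/
lemma abs_Gamma_ratio_sub_rpow_le {m a : ℝ} (hm : 1 ≤ m) (ha : 0 < a) (ha1 : a < 1) :
    |Gamma (m + a) / Gamma m - m ^ a| ≤ 1 := by
  have hm0 : 0 < m := by linarith
  have hG := Gamma_pos_of_pos hm0
  have hma : 0 < m + a := by linarith
  have hu : Gamma (m + a) / Gamma m ≤ m ^ a := by
    rw [div_le_iff₀ hG]; exact Gamma_add_le_rpow_mul hm0 ha ha1
  have hl : m ^ a * (m / (m + a)) ≤ Gamma (m + a) / Gamma m := by
    rw [le_div_iff₀ hG]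
    have h1 := mul_Gamma_le_rpow_mul hm0 ha ha1
    have h2 : m / (m + a) ≤ (m / (m + a)) ^ (1 - a) :=
      self_le_rpow_of_le_one (by positivity) ((div_le_one hma).2 (by linarith)) (by linarith)
    have h3 : m ^ a * (m / (m + a)) ^ (1 - a) * Gamma m ≤ Gamma (m + a) := by
      rw [div_rpow hm0.le hma.le, ← mul_div_assoc, ← rpow_add hm0, add_sub_cancel, rpow_one,
        div_mul_eq_mul_div, div_le_iff₀ (by positivity), mul_comm (Gamma (m + a))]
      exact h1
    refine le_trans ?_ h3
    gcongr
  have hma' : m ^ a ≤ m := rpow_le_self_of_one_le hm ha1.le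
  have hd : m ^ a - m ^ a * (m / (m + a)) ≤ 1 := by
    have : m ^ a - m ^ a * (m / (m + a)) = m ^ a * a / (m + a) := by field_simp; ring
    rw [this, div_le_one hma]
    nlinarith [rpow_pos_of_pos hm0 a]
  rw [abs_le]
  constructor <;> linarith

/-- (n + 1) / (1 - 2q) is a particular solution of the recursion, and the Gamma quotient solves the
homogeneous one. -/
lemma sqMean_eq_of_lt {q : ℝ} (hq : 0 < q) (hq2 : q < 1 / 2) (n : ℕ) :
    sqMean q n = ((n : ℝ) + 1) / (1 - 2 * q) -
      Gamma ((n : ℝ) + 1 + 2 * q) / Gamma ((n : ℝ) + 1) / ((1 - 2 * q) * Gamma (2 * q)) := by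
  have h1 : 1 - 2 * q ≠ 0 := by linarith
  have hG : Gamma (2 * q) ≠ 0 := (Gamma_pos_of_pos (by positivity)).ne'
  induction n with
  | zero =>
    simp only [sqMean, Nat.cast_zero, zero_add, Gamma_one, div_one]
    rw [add_comm, Gamma_add_one (by positivity)]
    field_simp
  | succ n ih =>
    have hn : (0 : ℝ) < (n : ℝ) + 1 := by positivity
    have hGn : Gamma ((n : ℝ) + 1) ≠ 0 := (Gamma_pos_of_pos hn).ne'
    rw [sqMean, ih]
    push_cast
    rw [show (n : ℝ) + 1 + 1 + 2 * q = ((n : ℝ) + 1 + 2 * q) + 1 by ring,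
      Gamma_add_one (s := (n : ℝ) + 1 + 2 * q) (by positivity), Gamma_add_one hn.ne']
    field_simp
    ring

/-- Divided by n + 1, the recursion at q = 1/2 just adds 1/(n + 2). -/
lemma sqMean_half_eq (n : ℕ) : sqMean (1 / 2) n = ((n : ℝ) + 1) * harmonic (n + 1) := by
  induction n with
  | zero => simp [sqMean]
  | succ n ih =>
    rw [sqMean, ih, harmonic_succ (n + 1)]
    push_cast
    field_simp

/-- `b` approximates the mean of `∑ N_j²` up to a bounded error. -/
lemma exists_abs_sqMean_sub_b_le {p : ℝ} (hp : 1 / 2 ≤ p) (hp1 : p < 1) :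
    ∃ K : ℝ, 0 < K ∧ ∀ n : ℕ, |sqMean (1 - p) n - b p (n + 1)| ≤ K := by
  rcases hp.eq_or_lt with rfl | hp'
  · refine ⟨1, one_pos, fun n => ?_⟩
    rw [show (1 - 1 / 2 : ℝ) = 1 / 2 by norm_num, sqMean_half_eq, b, if_pos rfl]
    -- With N = n + 1, Euler's constant lies between H_N - log (N + 1) and H_N - log N, so N (H_N -
    -- log N - γ) is in [0, N log (1 + 1/N)], a subset of [0, 1].
    have h1 := eulerMascheroniSeq_lt_eulerMascheroniConstant (n + 1)
    have h2 := eulerMascheroniConstant_lt_eulerMascheroniSeq' (n + 1)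
    simp only [eulerMascheroniSeq, eulerMascheroniSeq', Nat.add_eq_zero_iff, one_ne_zero,
      and_false, if_false] at h1 h2
    push_cast at h1 h2 ⊢
    set H : ℝ := (harmonic (n + 1) : ℝ)
    have hn : (0 : ℝ) < (n : ℝ) + 1 := by positivity
    have h3 : log ((n : ℝ) + 1 + 1) - log ((n : ℝ) + 1) ≤ 1 / ((n : ℝ) + 1) := by
      rw [← log_div (by positivity) hn.ne']
      refine (log_le_sub_one_of_pos (by positivity)).trans (le_of_eq ?_)
      field_simp
      ring
    have h4 : ((n : ℝ) + 1) * (H - log ((n : ℝ) + 1) - eulerMascheroniConstant) ≤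
        ((n : ℝ) + 1) * (1 / ((n : ℝ) + 1)) := by gcongr; linarith
    have h5 : 0 ≤ ((n : ℝ) + 1) * (H - log ((n : ℝ) + 1) - eulerMascheroniConstant) :=
      mul_nonneg hn.le (by linarith)
    rw [mul_one_div_cancel hn.ne'] at h4
    rw [abs_le]
    constructor <;> nlinarith
  · have h1 : 0 < 2 * p - 1 := by linarith
    have hG : 0 < Gamma (2 - 2 * p) := Gamma_pos_of_pos (by linarith)
    refine ⟨1 / ((2 * p - 1) * Gamma (2 - 2 * p)), by positivity, fun n => ?_⟩
    rw [sqMean_eq_of_lt (by linarith) (by linarith), b, if_neg hp'.ne',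
      show 1 - 2 * (1 - p) = 2 * p - 1 by ring, show 2 * (1 - p) = 2 - 2 * p by ring]
    push_cast
    rw [sub_sub_sub_cancel_left, ← sub_div, abs_div,
      abs_of_pos (show 0 < (2 * p - 1) * Gamma (2 - 2 * p) by positivity), abs_sub_comm]
    gcongr
    exact abs_Gamma_ratio_sub_rpow_le (by linarith [n.cast_nonneg (α := ℝ)]) (by linarith)
      (by linarith)

lemma le_sqMean {q : ℝ} (hq : 0 < q) (n : ℕ) : (n : ℝ) + 1 ≤ sqMean q n := by
  induction n with
  | zero => simp [sqMean]
  | succ n ih =>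
    rw [sqMean]
    push_cast
    have := sqMean_pos hq n
    have h : 0 ≤ 2 * q / (n + 1) * sqMean q n := by positivity
    linarith

end StepReinforced

namespace StepReinforced

open Real Set Filter Topology

/-! ### Comparison with the rate -/

lemma mul_sqrt_eq_rpow {y : ℝ} (hy : 0 < y) : y * √y = y ^ (3 / 2 : ℝ) := by
  rw [show (3 / 2 : ℝ) = 1 + 1 / 2 by norm_num, rpow_add hy, rpow_one, sqrt_eq_rpow]

lemma div_mul_sqrt_le {t c m β K : ℝ} (hm : 0 < m) (ht : t ≤ K * c) (hc : 0 ≤ c) (hK : 0 ≤ K)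
    (hβ : m / 2 ≤ β) : t / (β * √β) ≤ 4 * K * (c * m ^ (-(3 / 2) : ℝ)) := by
  have hβ0 : 0 < β := by linarith
  have h1 : m ^ (3 / 2 : ℝ) ≤ 4 * β ^ (3 / 2 : ℝ) := by
    calc m ^ (3 / 2 : ℝ) ≤ (2 * β) ^ (3 / 2 : ℝ) := by gcongr; linarith
      _ = 2 ^ (3 / 2 : ℝ) * β ^ (3 / 2 : ℝ) := mul_rpow (by norm_num) hβ0.le
      _ ≤ 4 * β ^ (3 / 2 : ℝ) := by
        gcongr
        calc (2 : ℝ) ^ (3 / 2 : ℝ) ≤ 2 ^ (2 : ℝ) :=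
              rpow_le_rpow_of_exponent_le (by norm_num) (by norm_num)
          _ = 4 := by norm_num
  have hmp : 0 < m ^ (3 / 2 : ℝ) := by positivity
  rw [mul_sqrt_eq_rpow hβ0, div_le_iff₀ (by positivity), rpow_neg hm.le]
  have h2 : 1 ≤ 4 * ((m ^ (3 / 2 : ℝ))⁻¹ * β ^ (3 / 2 : ℝ)) := by
    rw [mul_left_comm, ← div_eq_inv_mul, one_le_div hmp]
    exact h1
  calc t ≤ K * c * 1 := by linarith
    _ ≤ K * c * (4 * ((m ^ (3 / 2 : ℝ))⁻¹ * β ^ (3 / 2 : ℝ))) := by gcongr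
    _ = _ := by ring

lemma div_sq_le {x c m β M : ℝ} (hm : 0 < m) (hx : x ≤ M * m ^ c) (hM : 0 ≤ M)
    (hβ : m / 2 ≤ β) : x / β ^ 2 ≤ 4 * M * m ^ (c - 2) := by
  have hβ0 : 0 < β := by linarith
  rw [div_le_iff₀ (by positivity), rpow_sub hm, rpow_two]
  have h1 : m ^ 2 ≤ 4 * β ^ 2 := by nlinarith
  have h2 : 1 ≤ 4 * (β ^ 2 / m ^ 2) := by
    rw [← mul_div_assoc, one_le_div (by positivity)]; exact h1
  calc x ≤ M * m ^ c * 1 := by linarith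
    _ ≤ M * m ^ c * (4 * (β ^ 2 / m ^ 2)) := by gcongr
    _ = _ := by ring

/-- The bound for the three error terms, at time `n + 1`. -/
def ErrorBound (p K : ℝ) (n : ℕ) (x : ℝ) : Prop :=
  1 ≤ b p (n + 1) ∧ cubeMean (1 - p) n / (b p (n + 1) * √(b p (n + 1))) ≤ K * rate p (n + 1) ∧
    x / b p (n + 1) ^ 2 ≤ K * rate p (n + 1) ∧ 1 / b p (n + 1) ≤ K * rate p (n + 1)

/-- The recursive inequality satisfied by the variance of `∑ N_j²`. -/
def IsVarianceSeq (q : ℝ) (x : ℕ → ℝ) : Prop :=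
  x 0 = 0 ∧ ∀ n : ℕ, x (n + 1) ≤ (1 + 4 * q / (n + 1)) * x n + 4 * q / (n + 1) * cubeMean q n

lemma exists_half_le_b {p : ℝ} (hp : 1 / 2 ≤ p) (hp1 : p < 1) :
    ∃ N : ℕ, ∀ n ≥ N, 2 ≤ (n : ℝ) + 1 ∧ ((n : ℝ) + 1) / 2 ≤ b p (n + 1) := by
  obtain ⟨K, hK, h⟩ := exists_abs_sqMean_sub_b_le hp hp1
  obtain ⟨N, hN⟩ := exists_nat_ge (2 * K + 1)
  refine ⟨N, fun n hn => ?_⟩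
  have hn' : (N : ℝ) ≤ n := by exact_mod_cast hn
  have h1 := (abs_le.1 (h n)).2
  have h2 := le_sqMean (show 0 < 1 - p by linarith) n
  have h3 : (1 : ℝ) ≤ n := by
    have : (0 : ℝ) < n := by linarith
    exact_mod_cast this
  constructor <;> linarith

lemma exists_errorBound_of_two_thirds_lt {p : ℝ} (hp : 2 / 3 < p) (hp1 : p < 1) :
    ∃ K : ℝ, 0 < K ∧ ∃ N : ℕ, ∀ x, IsVarianceSeq (1 - p) x → ∀ n ≥ N, ErrorBound p K n (x n) := by
  have hq : 0 < 1 - p := by linarith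
  obtain ⟨K, hK, ht⟩ := exists_cubeMean_le_linear hq (by linarith)
  -- Here 4 (1 - p) < 4/3, so there is room: 3/2 is the exponent that gives exactly n^(-1/2) after
  -- division by b².
  obtain ⟨M, hM, hx⟩ := exists_variance_le_rpow (c := 3 / 2) (d := 1) hq (by norm_num)
    (by linarith) (by norm_num) hK (by simpa using ht)
  obtain ⟨N, hN⟩ := exists_half_le_b (p := p) (by linarith) hp1
  refine ⟨4 * K + 4 * M + 2, by positivity, N, fun x hxs n hn => ?_⟩
  obtain ⟨h2, hb⟩ := hN n hn
  have hm : (0 : ℝ) < (n : ℝ) + 1 := by positivity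
  have hr : rate p (n + 1) = ((n : ℝ) + 1) ^ (-(1 / 2) : ℝ) := by
    rw [rate, if_pos hp]; push_cast; rfl
  have hr0 : 0 < ((n : ℝ) + 1) ^ (-(1 / 2) : ℝ) := by positivity
  refine ⟨by linarith, ?_, ?_, ?_⟩
  · rw [hr]
    refine (div_mul_sqrt_le hm (ht n) hm.le hK.le hb).trans ?_
    have : ((n : ℝ) + 1) * ((n : ℝ) + 1) ^ (-(3 / 2) : ℝ) = ((n : ℝ) + 1) ^ (-(1 / 2) : ℝ) := by
      rw [← rpow_one_add' hm.le (by norm_num)]; norm_num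
    rw [this]
    gcongr
    linarith
  · rw [hr]
    refine (div_sq_le hm (hx x hxs.1 hxs.2 n) hM.le hb).trans ?_
    rw [show (3 / 2 - 2 : ℝ) = -(1 / 2) by norm_num]
    gcongr
    linarith
  · rw [hr]
    have h1 : 1 / b p (n + 1) ≤ 2 * ((n : ℝ) + 1) ^ (-1 : ℝ) := by
      rw [rpow_neg_one, ← div_eq_mul_inv, div_le_div_iff₀ (by linarith) hm]; linarith
    have h3 : ((n : ℝ) + 1) ^ (-1 : ℝ) ≤ ((n : ℝ) + 1) ^ (-(1 / 2) : ℝ) :=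
      rpow_le_rpow_of_exponent_le (by linarith) (by norm_num)
    nlinarith

lemma exists_errorBound_two_thirds :
    ∃ K : ℝ, 0 < K ∧ ∃ N : ℕ, ∀ x, IsVarianceSeq (1 - 2 / 3) x → ∀ n ≥ N,
      ErrorBound (2 / 3) K n (x n) := by
  have e : (1 - 2 / 3 : ℝ) = 1 / 3 := by norm_num
  rw [e]
  obtain ⟨K, hK, ht⟩ := exists_cubeMean_third_le
  -- A cruder power bound, free of logarithms, is enough to feed the variance recursion.
  obtain ⟨K', hK', ht'⟩ := exists_cubeMean_le_rpow (q := 1 / 3) (c := 5 / 4) (by norm_num)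
    (by norm_num) (by norm_num) (by norm_num)
  obtain ⟨M, hM, hx⟩ := exists_variance_le_rpow (q := 1 / 3) (c := 3 / 2) (d := 5 / 4)
    (by norm_num) (by norm_num) (by norm_num) (by norm_num) hK' ht'
  obtain ⟨N, hN⟩ := exists_half_le_b (p := 2 / 3) (by norm_num) (by norm_num)
  have hl2 : 0 < log 2 := log_pos one_lt_two
  refine ⟨4 * K + (4 * M + 2) / log 2, by positivity, N, fun x hxs n hn => ?_⟩
  obtain ⟨h2, hb⟩ := hN n hn
  have hm : (0 : ℝ) < (n : ℝ) + 1 := by positivity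
  have hr : rate (2 / 3) (n + 1) = ((n : ℝ) + 1) ^ (-(1 / 2) : ℝ) * log ((n : ℝ) + 1) := by
    rw [rate, if_neg (lt_irrefl _), if_pos rfl]; push_cast; rfl
  have hr0 : 0 < ((n : ℝ) + 1) ^ (-(1 / 2) : ℝ) := by positivity
  have hlog : log 2 ≤ log ((n : ℝ) + 1) := log_le_log (by norm_num) h2
  have hle : ∀ c : ℝ, 0 ≤ c → c * ((n : ℝ) + 1) ^ (-(1 / 2) : ℝ) ≤
      c / log 2 * (((n : ℝ) + 1) ^ (-(1 / 2) : ℝ) * log ((n : ℝ) + 1)) := by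
    intro c hc
    rw [div_mul_eq_mul_div, le_div_iff₀ hl2]
    calc _ = c * (((n : ℝ) + 1) ^ (-(1 / 2) : ℝ) * log 2) := by ring
      _ ≤ _ := by gcongr
  have hR : 0 < ((n : ℝ) + 1) ^ (-(1 / 2) : ℝ) * log ((n : ℝ) + 1) :=
    mul_pos hr0 (by linarith)
  refine ⟨by linarith, ?_, ?_, ?_⟩
  · rw [hr, e]
    have hn1 : 1 ≤ n := by
      have : (1 : ℝ) ≤ n := by linarith
      exact_mod_cast this
    refine (div_mul_sqrt_le hm (ht n hn1) (mul_nonneg hm.le (by linarith)) hK.le hb).trans ?_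
    have : ((n : ℝ) + 1) * log ((n : ℝ) + 1) * ((n : ℝ) + 1) ^ (-(3 / 2) : ℝ) =
        ((n : ℝ) + 1) ^ (-(1 / 2) : ℝ) * log ((n : ℝ) + 1) := by
      rw [mul_right_comm, ← rpow_one_add' hm.le (by norm_num)]; norm_num
    rw [this]
    gcongr
    have : 0 ≤ (4 * M + 2) / log 2 := by positivity
    linarith
  · rw [hr]
    refine (div_sq_le hm (hx x hxs.1 hxs.2 n) hM.le hb).trans ?_
    rw [show (3 / 2 - 2 : ℝ) = -(1 / 2) by norm_num]
    refine (hle (4 * M) (by positivity)).trans ?_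
    gcongr
    have : 4 * M / log 2 ≤ (4 * M + 2) / log 2 := by gcongr; linarith
    linarith
  · rw [hr]
    have h1 : 1 / b (2 / 3) (n + 1) ≤ 2 * ((n : ℝ) + 1) ^ (-1 : ℝ) := by
      rw [rpow_neg_one, ← div_eq_mul_inv, div_le_div_iff₀ (by linarith) hm]; linarith
    have h3 : ((n : ℝ) + 1) ^ (-1 : ℝ) ≤ ((n : ℝ) + 1) ^ (-(1 / 2) : ℝ) :=
      rpow_le_rpow_of_exponent_le (by linarith) (by norm_num)
    refine (h1.trans (mul_le_mul_of_nonneg_left h3 (by norm_num))).trans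
      ((hle 2 (by norm_num)).trans ?_)
    gcongr
    have : 2 / log 2 ≤ (4 * M + 2) / log 2 := by gcongr; linarith
    linarith

lemma exists_errorBound_of_half_lt {p : ℝ} (hp : 1 / 2 < p) (hp1 : p < 2 / 3) :
    ∃ K : ℝ, 0 < K ∧ ∃ N : ℕ, ∀ x, IsVarianceSeq (1 - p) x → ∀ n ≥ N, ErrorBound p K n (x n) := by
  have hq : 0 < 1 - p := by linarith
  obtain ⟨K, hK, ht⟩ := exists_cubeMean_le_rpow (c := 3 * (1 - p)) hq (by linarith) (by linarith)
    le_rfl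
  obtain ⟨M, hM, hx⟩ := exists_variance_le_rpow (c := 4 * (1 - p)) hq (by linarith)
    le_rfl (by linarith) hK ht
  obtain ⟨N, hN⟩ := exists_half_le_b (p := p) (by linarith) (by linarith)
  refine ⟨4 * K + 4 * M + 2, by positivity, N, fun x hxs n hn => ?_⟩
  obtain ⟨h2, hb⟩ := hN n hn
  have hm : (0 : ℝ) < (n : ℝ) + 1 := by positivity
  have hr : rate p (n + 1) = ((n : ℝ) + 1) ^ (3 / 2 - 3 * p) := by
    rw [rate, if_neg (by linarith), if_neg hp1.ne, if_pos hp]; push_cast; rfl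
  have hr0 : 0 < ((n : ℝ) + 1) ^ (3 / 2 - 3 * p) := by positivity
  refine ⟨by linarith, ?_, ?_, ?_⟩
  · rw [hr]
    refine (div_mul_sqrt_le hm (ht n) (by positivity) hK.le hb).trans ?_
    rw [← rpow_add hm, show 3 * (1 - p) + -(3 / 2) = 3 / 2 - 3 * p by ring]
    gcongr
    linarith
  · rw [hr]
    refine (div_sq_le hm (hx x hxs.1 hxs.2 n) hM.le hb).trans ?_
    -- The variance exponent 2 - 4p is at most 3/2 - 3p precisely because p ≥ 1/2.
    have h3 : ((n : ℝ) + 1) ^ (4 * (1 - p) - 2) ≤ ((n : ℝ) + 1) ^ (3 / 2 - 3 * p) :=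
      rpow_le_rpow_of_exponent_le (by linarith) (by linarith)
    nlinarith
  · rw [hr]
    have h1 : 1 / b p (n + 1) ≤ 2 * ((n : ℝ) + 1) ^ (-1 : ℝ) := by
      rw [rpow_neg_one, ← div_eq_mul_inv, div_le_div_iff₀ (by linarith) hm]; linarith
    have h3 : ((n : ℝ) + 1) ^ (-1 : ℝ) ≤ ((n : ℝ) + 1) ^ (3 / 2 - 3 * p) :=
      rpow_le_rpow_of_exponent_le (by linarith) (by linarith)
    nlinarith

lemma exists_errorBound_half :
    ∃ K : ℝ, 0 < K ∧ ∃ N : ℕ, ∀ x, IsVarianceSeq (1 - 1 / 2) x → ∀ n ≥ N,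
      ErrorBound (1 / 2) K n (x n) := by
  have e : (1 - 1 / 2 : ℝ) = 1 / 2 := by norm_num
  rw [e]
  obtain ⟨K, hK, ht⟩ := exists_cubeMean_le_rpow (q := 1 / 2) (c := 3 / 2) (by norm_num)
    (by norm_num) (by norm_num) (by norm_num)
  obtain ⟨M, hM, hx⟩ := exists_variance_le_rpow (q := 1 / 2) (c := 2) (d := 3 / 2)
    (by norm_num) (by norm_num) (by norm_num) (by norm_num) hK ht
  have hl2 : 0 < log 2 := log_pos one_lt_two
  refine ⟨K + (M + 1) * log 2 ^ (-(1 / 2) : ℝ), by positivity, 1, fun x hxs n hn => ?_⟩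
  have hm : (0 : ℝ) < (n : ℝ) + 1 := by positivity
  have hn1 : (1 : ℝ) ≤ n := by exact_mod_cast hn
  have hlog : log 2 ≤ log ((n : ℝ) + 1) := log_le_log (by norm_num) (by linarith)
  have hr : rate (1 / 2) (n + 1) = log ((n : ℝ) + 1) ^ (-(3 / 2) : ℝ) := by
    rw [rate, if_neg (by norm_num), if_neg (by norm_num), if_neg (by norm_num)]; push_cast; rfl
  set ℓ := log ((n : ℝ) + 1) with hℓ
  have hℓ0 : 0 < ℓ := by linarith
  have hb : ((n : ℝ) + 1) * ℓ ≤ b (1 / 2) (n + 1) := by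
    rw [b, if_pos rfl]
    push_cast
    have := one_half_lt_eulerMascheroniConstant
    have h3 : 0 < eulerMascheroniConstant * ((n : ℝ) + 1) := by positivity
    linarith
  have hmℓ : 1 ≤ ((n : ℝ) + 1) * ℓ := by
    have := log_two_gt_d9
    nlinarith
  have hb0 : 0 < b (1 / 2) (n + 1) := by linarith
  have hR : 0 < ℓ ^ (-(3 / 2) : ℝ) := by positivity
  -- The variance and bias terms are O(ℓ^(-2)); as ℓ ≥ log 2, this is absorbed by the rate ℓ^(-3/2).
  have h2 : (ℓ ^ 2)⁻¹ ≤ log 2 ^ (-(1 / 2) : ℝ) * ℓ ^ (-(3 / 2) : ℝ) := by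
    have h3 : (ℓ ^ 2)⁻¹ = ℓ ^ (-(1 / 2) : ℝ) * ℓ ^ (-(3 / 2) : ℝ) := by
      rw [← rpow_add hℓ0, ← rpow_two, ← rpow_neg hℓ0.le]; norm_num
    rw [h3]
    gcongr ?_ * _
    exact rpow_le_rpow_of_nonpos hl2 hlog (by norm_num)
  refine ⟨by linarith, ?_, ?_, ?_⟩
  · rw [hr, e, mul_sqrt_eq_rpow hb0, div_le_iff₀ (by positivity)]
    have h3 : (((n : ℝ) + 1) * ℓ) ^ (3 / 2 : ℝ) ≤ b (1 / 2) (n + 1) ^ (3 / 2 : ℝ) := by gcongr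
    rw [mul_rpow hm.le hℓ0.le] at h3
    have h4 : ℓ ^ (-(3 / 2) : ℝ) * ℓ ^ (3 / 2 : ℝ) = 1 := by
      rw [← rpow_add hℓ0]; norm_num
    calc cubeMean (1 / 2) n ≤ K * ((n : ℝ) + 1) ^ (3 / 2 : ℝ) := ht n
      _ = K * ℓ ^ (-(3 / 2) : ℝ) * (((n : ℝ) + 1) ^ (3 / 2 : ℝ) * ℓ ^ (3 / 2 : ℝ)) := by
          linear_combination (-(K * ((n : ℝ) + 1) ^ (3 / 2 : ℝ))) * h4
      _ ≤ (K + (M + 1) * log 2 ^ (-(1 / 2) : ℝ)) * ℓ ^ (-(3 / 2) : ℝ) *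
          b (1 / 2) (n + 1) ^ (3 / 2 : ℝ) := by
          gcongr
          have : 0 ≤ (M + 1) * log 2 ^ (-(1 / 2) : ℝ) := by positivity
          linarith
  · rw [hr]
    have h3 : x n / b (1 / 2) (n + 1) ^ 2 ≤ M * (ℓ ^ 2)⁻¹ := by
      rw [div_le_iff₀ (by positivity)]
      have h4 := hx x hxs.1 hxs.2 n
      rw [rpow_two] at h4
      calc x n ≤ M * ((n : ℝ) + 1) ^ 2 := h4
        _ = M * (ℓ ^ 2)⁻¹ * (((n : ℝ) + 1) * ℓ) ^ 2 := by field_simp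
        _ ≤ M * (ℓ ^ 2)⁻¹ * b (1 / 2) (n + 1) ^ 2 := by gcongr
    have h5 : 0 < log 2 ^ (-(1 / 2) : ℝ) := by positivity
    have h6 : 0 < log 2 ^ (-(1 / 2) : ℝ) * ℓ ^ (-(3 / 2) : ℝ) := by positivity
    nlinarith [mul_le_mul_of_nonneg_left h2 hM.le, mul_pos hK hR]
  · rw [hr]
    have h3 : 1 / b (1 / 2) (n + 1) ≤ (ℓ ^ 2)⁻¹ := by
      rw [← one_div]
      apply one_div_le_one_div_of_le (by positivity)
      have : ℓ ≤ (n : ℝ) + 1 := by linarith [log_le_sub_one_of_pos hm]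
      nlinarith
    have h6 : 0 < log 2 ^ (-(1 / 2) : ℝ) * ℓ ^ (-(3 / 2) : ℝ) := by positivity
    nlinarith [mul_pos hK hR, mul_pos hM h6]

lemma exists_errorBound {p : ℝ} (hp : 1 / 2 ≤ p) (hp1 : p < 1) :
    ∃ K : ℝ, 0 < K ∧ ∃ N : ℕ, ∀ x, IsVarianceSeq (1 - p) x → ∀ n ≥ N, ErrorBound p K n (x n) := by
  rcases hp.eq_or_lt with rfl | hp'
  · exact exists_errorBound_half
  rcases lt_trichotomy p (2 / 3) with h | rfl | h
  · exact exists_errorBound_of_half_lt hp' h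
  · exact exists_errorBound_two_thirds
  · exact exists_errorBound_of_two_thirds_lt h hp1

/-- The only vanishing values come from log 1 = 0, at n = 1 with p = 1/2 or p = 2/3; hence the
exclusion in the theorem. -/
lemma rate_pos {p : ℝ} {n : ℕ} (hn : 1 ≤ n) (h : n = 1 → p ≠ 1 / 2 ∧ p ≠ 2 / 3)
    (hp : 1 / 2 ≤ p) : 0 < rate p n := by
  have hn0 : (0 : ℝ) < n := by exact_mod_cast hn
  have hlog : n ≠ 1 → 0 < log (n : ℝ) := fun h1 => by
    apply log_pos
    have : 1 < n := by omega
    exact_mod_cast this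
  rw [rate]
  split_ifs with h1 h2 h3
  · positivity
  · have := hlog fun h1 => (h h1).2 h2
    positivity
  · positivity
  · have := hlog fun h4 => (h h4).1 (le_antisymm (not_lt.1 h3) hp)
    positivity

end StepReinforced

namespace StepReinforced

open Finset

/-! ### Labels of the steps along a path -/

/-- The label of the `(n + 1)`-st step, i.e. the (zero-based) index of the innovation that it
repeats, along a path `a n = ε_{n+2}`, `c n = U_{n+2}`. -/
def label (a c : ℕ → ℕ) : ℕ → ℕ
  | 0 => 0
  -- U counts steps from 1, labels count from 0, hence `c n - 1`. The `min` makes the recursion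
  -- well-founded for arbitrary `c` and is inactive almost surely.
  | n + 1 => if a n = 0 then label a c (min (c n - 1) n) else ∑ j ∈ range (n + 1), a j
termination_by n => n
decreasing_by omega

lemma label_succ (a c : ℕ → ℕ) (n : ℕ) : label a c (n + 1) =
    if a n = 0 then label a c (min (c n - 1) n) else ∑ j ∈ range (n + 1), a j := by
  rw [label]

lemma newCount_add_two {e : ℕ → ℕ} (he : e 1 = 1) (n : ℕ) :
    newCount e (n + 2) = ∑ j ∈ range (n + 1), e (j + 2) + 1 := by
  have h : Icc 1 (n + 2) = Ico 1 (n + 3) := by ext; simp; omega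
  rw [newCount, h, sum_eq_sum_Ico_succ_bot (by omega), he, add_comm,
    sum_Ico_eq_sum_range]
  simp [add_comm]

lemma step_add_one_eq (x : ℕ → ℝ) {e u : ℕ → ℕ} (he : e 1 = 1) {N : ℕ}
    (hu : ∀ n < N, 1 ≤ u (n + 2) ∧ u (n + 2) ≤ n + 1) (i : ℕ) (hi : i ≤ N) :
    step x e u (i + 1) = x (label (fun j => e (j + 2)) (fun j => u (j + 2)) i + 1) := by
  induction i using Nat.strong_induction_on with
  | _ i ih =>
    match i with
    | 0 => simp [step, label]
    | n + 1 =>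
      obtain ⟨h1, h2⟩ := hu n (by omega)
      rw [step, label_succ]
      split_ifs with h3 h4
      · have h5 := ih (u (n + 2) - 1) (by omega) (by omega)
        rw [Nat.sub_add_cancel h1] at h5
        rw [h5, min_eq_left (by omega)]
      · omega
      · rw [newCount_add_two he]

lemma walk_add_one_eq (x : ℕ → ℝ) {e u : ℕ → ℕ} (he : e 1 = 1) {n : ℕ}
    (hu : ∀ k < n, 1 ≤ u (k + 2) ∧ u (k + 2) ≤ k + 1) :
    walk x e u (n + 1) = ∑ i ∈ range (n + 1),
      x (label (fun j => e (j + 2)) (fun j => u (j + 2)) i + 1) := by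
  have h : Icc 1 (n + 1) = Ico 1 (n + 2) := by ext; simp; omega
  rw [walk, h, sum_Ico_eq_sum_range]
  refine sum_congr rfl fun i hi => ?_
  rw [mem_range] at hi
  rw [add_comm 1 i]
  exact step_add_one_eq x he hu i (by omega)

lemma label_le_sum (a c : ℕ → ℕ) (i : ℕ) : label a c i ≤ ∑ j ∈ range i, a j := by
  induction i using Nat.strong_induction_on with
  | _ i ih =>
    match i with
    | 0 => simp [label]
    | n + 1 =>
      rw [label_succ]
      split_ifs with h
      · refine (ih _ (by omega)).trans (sum_le_sum_of_subset ?_)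
        exact range_subset_range.2 (by omega)
      · exact le_rfl

/-- An innovation opens a new block, since all earlier labels are bounded by the earlier partial
sum. -/
lemma label_lt_label_succ {a c : ℕ → ℕ} {n i : ℕ} (hn : a n ≠ 0) (hi : i ≤ n) :
    label a c i < label a c (n + 1) := by
  rw [label_succ, if_neg hn, sum_range_succ]
  have h1 := label_le_sum a c i
  have h2 : ∑ j ∈ range i, a j ≤ ∑ j ∈ range n, a j :=
    sum_le_sum_of_subset (range_subset_range.2 hi)
  omega

lemma label_congr {a a' c c' : ℕ → ℕ} {n : ℕ} (ha : ∀ j < n, a j = a' j)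
    (hc : ∀ j < n, c j = c' j) (i : ℕ) (hi : i ≤ n) : label a c i = label a' c' i := by
  induction i using Nat.strong_induction_on with
  | _ i ih =>
    match i with
    | 0 => simp [label]
    | m + 1 =>
      rw [label_succ, label_succ, ha m (by omega), hc m (by omega)]
      split_ifs with h
      · exact ih _ (by omega) (by omega)
      · refine sum_congr rfl fun j hj => ha j ?_
        rw [mem_range] at hj
        omega

/-- The number of the first `n + 1` steps with the same label as step `i + 1`. -/
def mult (a c : ℕ → ℕ) (n i : ℕ) : ℝ :=
  ∑ k ∈ range (n + 1), if label a c k = label a c i then 1 else 0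

/-- `∑ N_j²` at time `n + 1`. -/
def sqSum (a c : ℕ → ℕ) (n : ℕ) : ℝ := ∑ i ∈ range (n + 1), mult a c n i

/-- `∑ N_j³` at time `n + 1`. -/
def cubeSum (a c : ℕ → ℕ) (n : ℕ) : ℝ := ∑ i ∈ range (n + 1), mult a c n i ^ 2

section

variable (a c : ℕ → ℕ) (n i : ℕ)

lemma mult_nonneg : 0 ≤ mult a c n i := sum_nonneg fun k _ => by split_ifs <;> norm_num

lemma mult_le : mult a c n i ≤ n + 1 := by
  calc mult a c n i ≤ ∑ k ∈ range (n + 1), (1 : ℝ) :=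
        sum_le_sum fun k _ => by split_ifs <;> norm_num
    _ = n + 1 := by simp

lemma sqSum_nonneg : 0 ≤ sqSum a c n := sum_nonneg fun i _ => mult_nonneg a c n i

lemma sqSum_le : sqSum a c n ≤ ((n : ℝ) + 1) ^ 2 := by
  calc sqSum a c n ≤ ∑ k ∈ range (n + 1), ((n : ℝ) + 1) := sum_le_sum fun k _ => mult_le a c n k
    _ = _ := by simp; ring

lemma cubeSum_nonneg : 0 ≤ cubeSum a c n := sum_nonneg fun _ _ => sq_nonneg _

lemma one_le_mult (hi : i ≤ n) : 1 ≤ mult a c n i := by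
  have h := single_le_sum (f := fun k => if label a c k = label a c i then (1 : ℝ) else 0)
    (fun k _ => by split_ifs <;> norm_num) (mem_range.2 (show i < n + 1 by omega))
  simp only [if_true] at h
  exact h

lemma sqSum_pos : 0 < sqSum a c n := by
  refine sum_pos (fun i hi => ?_) ⟨0, by simp⟩
  rw [mem_range] at hi
  linarith [one_le_mult a c n i (by omega)]

lemma sqSum_zero : sqSum a c 0 = 1 := by
  rw [sqSum, sum_range_one, mult, sum_range_one, if_pos rfl]

lemma cubeSum_zero : cubeSum a c 0 = 1 := by
  rw [cubeSum, sum_range_one, mult, sum_range_one, if_pos rfl, one_pow]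

lemma mult_succ : mult a c (n + 1) i = mult a c n i +
    if label a c (n + 1) = label a c i then 1 else 0 := by
  rw [mult, sum_range_succ]; rfl

/-- (N + 1)² = N² + 2N + 1 for the block joined. The index n + 1 lies outside the first n + 1 steps,
so `mult a c n (n + 1)` is the size of that block just before the new step, and 0 for an innovation.
-/
lemma sqSum_succ : sqSum a c (n + 1) = sqSum a c n + 2 * mult a c n (n + 1) + 1 := by
  rw [sqSum, sum_range_succ]
  simp_rw [mult_succ]
  rw [sum_add_distrib]
  simp only [eq_comm (a := label a c (n + 1)), if_true]
  rw [← mult, ← sqSum]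
  ring

lemma cubeSum_succ : cubeSum a c (n + 1) = cubeSum a c n + 3 * mult a c n (n + 1) ^ 2 +
    3 * mult a c n (n + 1) + 1 := by
  have h : ∀ i, (mult a c n i + if label a c i = label a c (n + 1) then 1 else 0) ^ 2 =
      mult a c n i ^ 2 + (2 * mult a c n (n + 1) + 1) *
        if label a c i = label a c (n + 1) then 1 else 0 := by
    intro i
    split_ifs with h
    · have : mult a c n i = mult a c n (n + 1) := by rw [mult, h]; rfl
      rw [this]; ring
    · ring
  rw [cubeSum, sum_range_succ]
  simp_rw [mult_succ]
  simp only [eq_comm (a := label a c (n + 1)), if_true]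
  simp_rw [h]
  rw [sum_add_distrib, ← mul_sum, ← mult, ← cubeSum]
  ring

lemma mult_self_succ : mult a c n (n + 1) =
    if a n = 0 then mult a c n (min (c n - 1) n) else 0 := by
  split_ifs with h
  · rw [mult, label_succ, if_pos h, ← mult]
  · refine sum_eq_zero fun k hk => ?_
    rw [mem_range] at hk
    rw [if_neg (label_lt_label_succ h (by omega)).ne]

variable {a c n i}

lemma mult_congr {a' c' : ℕ → ℕ} (ha : ∀ j < n, a j = a' j) (hc : ∀ j < n, c j = c' j)
    (hi : i ≤ n) : mult a c n i = mult a' c' n i := by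
  refine sum_congr rfl fun k hk => ?_
  rw [mem_range] at hk
  rw [label_congr ha hc k (by omega), label_congr ha hc i hi]

lemma sqSum_congr {a' c' : ℕ → ℕ} (ha : ∀ j < n, a j = a' j) (hc : ∀ j < n, c j = c' j) :
    sqSum a c n = sqSum a' c' n := by
  refine sum_congr rfl fun k hk => ?_
  rw [mem_range] at hk
  exact mult_congr ha hc (by omega)

end

/-! ### Grouping the steps by label -/

/-- The number of the first `n + 1` steps with label `j`. -/
def labelCount (a c : ℕ → ℕ) (n j : ℕ) : ℕ := #{k ∈ range (n + 1) | label a c k = j}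

/-- The labels of the first `n + 1` steps. -/
def labels (a c : ℕ → ℕ) (n : ℕ) : Finset ℕ := (range (n + 1)).image (label a c)

lemma mult_eq_labelCount (a c : ℕ → ℕ) (n i : ℕ) :
    mult a c n i = labelCount a c n (label a c i) := by
  rw [mult, labelCount, card_filter]
  push_cast
  rfl

/-- Turns the walk into a weighted sum over distinct labels, and the sums over steps in `sqSum` and
`cubeSum` into sums of N_j² and N_j³. -/
lemma sum_label_eq (a c : ℕ → ℕ) (n : ℕ) (f : ℕ → ℝ) :
    ∑ i ∈ range (n + 1), f (label a c i) = ∑ j ∈ labels a c n, labelCount a c n j * f j := by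
  rw [sum_comp f (label a c)]
  simp [labels, labelCount]

lemma sqSum_eq_sum_labels (a c : ℕ → ℕ) (n : ℕ) :
    sqSum a c n = ∑ j ∈ labels a c n, (labelCount a c n j : ℝ) ^ 2 := by
  simp_rw [sqSum, mult_eq_labelCount]
  rw [sum_label_eq a c n fun j => (labelCount a c n j : ℝ)]
  simp_rw [sq]

lemma cubeSum_eq_sum_labels (a c : ℕ → ℕ) (n : ℕ) :
    cubeSum a c n = ∑ j ∈ labels a c n, |(labelCount a c n j : ℝ)| ^ 3 := by
  simp_rw [cubeSum, mult_eq_labelCount]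
  rw [sum_label_eq a c n fun j => (labelCount a c n j : ℝ) ^ 2]
  refine sum_congr rfl fun j _ => ?_
  rw [Nat.abs_cast]
  ring

/-! ### Measurability -/

lemma measurable_label (i : ℕ) :
    Measurable fun z : (ℕ → ℕ) × (ℕ → ℕ) => label z.1 z.2 i := by
  induction i using Nat.strong_induction_on with
  | _ i ih =>
    match i with
    | 0 => simp [label]
    | n + 1 =>
      have h1 : Measurable fun z : (ℕ → ℕ) × (ℕ → ℕ) => z.1 n := by fun_prop
      have h2 : Measurable fun z : (ℕ → ℕ) × (ℕ → ℕ) => min (z.2 n - 1) n :=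
        (measurable_from_top (f := fun k : ℕ => min (k - 1) n)).comp
          (show Measurable fun z : (ℕ → ℕ) × (ℕ → ℕ) => z.2 n by fun_prop)
      have h3 : Measurable fun z : (ℕ → ℕ) × (ℕ → ℕ) => ∑ j ∈ range (n + 1), z.1 j := by fun_prop
      -- The index is itself random, so the value is split over the finitely many values it can
      -- take.
      have h4 : (fun z : (ℕ → ℕ) × (ℕ → ℕ) => label z.1 z.2 (min (z.2 n - 1) n)) = fun z =>
          ∑ i ∈ range (n + 1), if min (z.2 n - 1) n = i then label z.1 z.2 i else 0 := by
        ext z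
        rw [sum_ite_eq, if_pos (mem_range.2 (by omega))]
      have h5 : Measurable fun z : (ℕ → ℕ) × (ℕ → ℕ) =>
          label z.1 z.2 (min (z.2 n - 1) n) := by
        rw [h4]
        refine measurable_fun_sum _ fun i hi => ?_
        rw [mem_range] at hi
        exact Measurable.ite (h2 (measurableSet_singleton i)) (ih i (by omega)) measurable_const
      simp_rw [label_succ]
      exact Measurable.ite (h1 (measurableSet_singleton 0)) h5 h3

lemma measurable_mult (n i : ℕ) :
    Measurable fun z : (ℕ → ℕ) × (ℕ → ℕ) => mult z.1 z.2 n i := by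
  refine measurable_fun_sum _ fun k _ => ?_
  exact Measurable.ite (measurableSet_eq_fun (measurable_label k) (measurable_label i))
    measurable_const measurable_const

lemma measurable_sqSum (n : ℕ) : Measurable fun z : (ℕ → ℕ) × (ℕ → ℕ) => sqSum z.1 z.2 n :=
  measurable_fun_sum _ fun i _ => measurable_mult n i

lemma measurable_sum_apply_label (n : ℕ) :
    Measurable fun z : ((ℕ → ℕ) × (ℕ → ℕ)) × (ℕ → ℝ) =>
      ∑ i ∈ range (n + 1), z.2 (label z.1.1 z.1.2 i) := by
  refine measurable_fun_sum _ fun i _ => ?_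
  have h : Measurable fun w : (ℕ → ℝ) × ℕ => w.1 w.2 :=
    measurable_from_prod_countable_left fun k => by
      change Measurable fun x : ℕ → ℝ => x k
      fun_prop
  exact h.comp (measurable_snd.prodMk ((measurable_label i).comp measurable_fst))

end StepReinforced

namespace StepReinforced

open Finset Filter

/-! ### Consequences of independence -/

lemma measurable_ite_eq {α : Type*} [MeasurableSpace α] {f : α → ℕ} (hf : Measurable f) (k : ℕ) :
    Measurable fun x => if f x = k then (1 : ℝ) else 0 :=
  Measurable.ite (hf (measurableSet_singleton k)) measurable_const measurable_const

section Decoupling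

variable {Ω : Type*} [MeasurableSpace Ω] {P : Measure Ω}

/-- Fubini for the product law: the first variable is frozen while the second is integrated. -/
lemma integral_comp_eq_of_indepFun [IsProbabilityMeasure P] {α β : Type*} [MeasurableSpace α] [MeasurableSpace β]
    {A : Ω → α} {B : Ω → β} (hA : Measurable A) (hB : Measurable B) (h : IndepFun A B P)
    {g : α → β → ℝ} (hg : Measurable (Function.uncurry g)) {C : ℝ} (hC : ∀ a b, |g a b| ≤ C) :
    ∫ ω, g (A ω) (B ω) ∂P = ∫ ω, ∫ ω', g (A ω) (B ω') ∂P ∂P := by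
  have hmap := (indepFun_iff_map_prod_eq_prod_map_map hA.aemeasurable hB.aemeasurable).1 h
  have : IsProbabilityMeasure (P.map A) := Measure.isProbabilityMeasure_map hA.aemeasurable
  have : IsProbabilityMeasure (P.map B) := Measure.isProbabilityMeasure_map hB.aemeasurable
  have h1 : ∫ ω, g (A ω) (B ω) ∂P = ∫ z, Function.uncurry g z ∂(P.map fun ω => (A ω, B ω)) := by
    rw [integral_map (hA.prodMk hB).aemeasurable hg.aestronglyMeasurable]
    rfl
  have hi : Integrable (Function.uncurry g) ((P.map A).prod (P.map B)) :=
    Integrable.of_bound hg.aestronglyMeasurable C (Eventually.of_forall fun z => hC z.1 z.2)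
  rw [h1, hmap, integral_prod _ hi]
  refine (integral_map hA.aemeasurable
    hg.stronglyMeasurable.integral_prod_right.aestronglyMeasurable).trans ?_
  refine integral_congr_ae (Eventually.of_forall fun ω => ?_)
  exact integral_map hB.aemeasurable (hg.of_uncurry_left).aestronglyMeasurable

lemma integral_ite_mul_of_iIndepFun {Z : ℕ → Ω → ℕ} (hZ : ∀ n, Measurable (Z n))
    (hi : iIndepFun Z P) (n k : ℕ) {F : (ℕ → ℕ) → ℝ} (hF : Measurable F)
    (hFc : ∀ z z' : ℕ → ℕ, (∀ j < n, z j = z' j) → F z = F z') :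
    ∫ ω, (if Z n ω = k then 1 else 0) * F (fun j => Z j ω) ∂P =
      P.real {ω | Z n ω = k} * ∫ ω, F (fun j => Z j ω) ∂P := by
  have hind := hi.indepFun_finset {n} (range n) (by simp) hZ
  -- Extension by zero: `F` becomes a function of the first n coordinates alone, to which
  -- finite-block independence applies.
  set ext : (range n → ℕ) → ℕ → ℕ := fun z j => if h : j ∈ range n then z ⟨j, h⟩ else 0 with hext
  have hextm : Measurable ext := by
    refine measurable_pi_lambda _ fun j => ?_
    by_cases h : j ∈ range n
    · simp only [hext, dif_pos h]; fun_prop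
    · simp only [hext, dif_neg h]; fun_prop
  have hFe : ∀ ω, F (fun j => Z j ω) = F (ext fun i => Z i ω) := fun ω => by
    refine hFc _ _ fun j hj => ?_
    simp [hext, hj]
  have hm1 : Measurable fun y : ({n} : Finset ℕ) → ℕ =>
      if y ⟨n, mem_singleton_self n⟩ = k then (1 : ℝ) else 0 :=
    measurable_ite_eq (by fun_prop) k
  have hcomp := hind.comp hm1 (hF.comp hextm)
  have hm2 : Measurable fun ω => F (ext fun i => Z i ω) :=
    (hF.comp hextm).comp (measurable_pi_lambda _ fun i => hZ i)
  have hm3 : Measurable fun ω => if Z n ω = k then (1 : ℝ) else 0 :=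
    measurable_ite_eq (hZ n) k
  have h := hcomp.integral_fun_mul_eq_mul_integral hm3.aestronglyMeasurable
    hm2.aestronglyMeasurable
  simp only [Function.comp] at h
  simp_rw [hFe]
  rw [h]
  congr 1
  have : ∀ ω, (if Z n ω = k then (1 : ℝ) else 0) =
      (Z n ⁻¹' {k}).indicator (1 : Ω → ℝ) ω := fun ω => by
    simp [Set.indicator]
  simp_rw [this]
  rw [integral_indicator_one (hZ n (measurableSet_singleton k))]
  rfl

end Decoupling

/-! ### Moments of the label counts -/

/-- The two sequences `ε_{n+2}` and `U_{n+2}` that drive the labels. -/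
structure IsLabelDriving {Ω : Type*} [MeasurableSpace Ω] (P : Measure Ω) (q : ℝ)
    (A B : ℕ → Ω → ℕ) : Prop where
  measurable_A : ∀ n, Measurable (A n)
  measurable_B : ∀ n, Measurable (B n)
  indep_A : iIndepFun A P
  indep_B : iIndepFun B P
  indep : IndepFun (fun ω n => A n ω) (fun ω n => B n ω) P
  prob_A : ∀ n, P.real {ω | A n ω = 0} = q
  prob_B : ∀ n k, 1 ≤ k → k ≤ n + 1 → P.real {ω | B n ω = k} = 1 / ((n : ℝ) + 1)

namespace IsLabelDriving

variable {Ω : Type*} [MeasurableSpace Ω] {P : Measure Ω} {q : ℝ} {A B : ℕ → Ω → ℕ}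

lemma measurable_pair (h : IsLabelDriving P q A B) :
    Measurable fun ω => ((fun n => A n ω), (fun n => B n ω)) :=
  (measurable_pi_lambda _ h.measurable_A).prodMk (measurable_pi_lambda _ h.measurable_B)

variable [IsProbabilityMeasure P]

/-- The n + 1 prescribed probabilities 1/(n + 1) already add up to 1. -/
lemma ae_mem_range (h : IsLabelDriving P q A B) (n : ℕ) :
    ∀ᵐ ω ∂P, 1 ≤ B n ω ∧ B n ω ≤ n + 1 := by
  have hset : {ω | 1 ≤ B n ω ∧ B n ω ≤ n + 1} = ⋃ k ∈ Icc 1 (n + 1), {ω | B n ω = k} := by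
    ext ω; simp
  have hmeas : MeasurableSet {ω | 1 ≤ B n ω ∧ B n ω ≤ n + 1} := by
    rw [hset]
    exact Finset.measurableSet_biUnion _ fun k _ => h.measurable_B n (measurableSet_singleton k)
  have h1 : P.real {ω | 1 ≤ B n ω ∧ B n ω ≤ n + 1} = 1 := by
    rw [hset, measureReal_biUnion_finset]
    · rw [sum_congr rfl fun k hk => h.prob_B n k (mem_Icc.1 hk).1 (mem_Icc.1 hk).2]
      simp
      field_simp
    · intro i _ j _ hij
      refine Set.disjoint_left.2 fun ω h1 h2 => hij ?_
      exact (show B n ω = i from h1).symm.trans h2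
    · exact fun k _ => h.measurable_B n (measurableSet_singleton k)
  have h2 : P {ω | 1 ≤ B n ω ∧ B n ω ≤ n + 1} = 1 := by
    rw [measureReal_def] at h1
    rw [← ENNReal.ofReal_toReal (measure_ne_top P _), h1, ENNReal.ofReal_one]
  exact mem_ae_iff_prob_eq_one hmeas |>.2 h2

lemma integrable_comp (h : IsLabelDriving P q A B) {f : (ℕ → ℕ) → (ℕ → ℕ) → ℝ}
    (hf : Measurable fun z : (ℕ → ℕ) × (ℕ → ℕ) => f z.1 z.2) {C : ℝ}
    (hC : ∀ a c, |f a c| ≤ C) : Integrable (fun ω => f (fun j => A j ω) (fun j => B j ω)) P :=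
  Integrable.of_bound (hf.comp h.measurable_pair).aestronglyMeasurable C
    (Eventually.of_forall fun _ => hC _ _)

/-- Freeze the A-sequence and split off `B n` from the earlier B's, then split off `A n` from the
earlier A's. -/
lemma integral_ite_ite_mul (h : IsLabelDriving P q A B) (n : ℕ) {k : ℕ} (hk : 1 ≤ k)
    (hkn : k ≤ n + 1) {f : (ℕ → ℕ) → (ℕ → ℕ) → ℝ}
    (hf : Measurable fun z : (ℕ → ℕ) × (ℕ → ℕ) => f z.1 z.2) {C : ℝ} (hC : ∀ a c, |f a c| ≤ C)
    (hfc : ∀ a a' c c' : ℕ → ℕ, (∀ j < n, a j = a' j) → (∀ j < n, c j = c' j) →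
      f a c = f a' c') :
    ∫ ω, (if A n ω = 0 then 1 else 0) * ((if B n ω = k then 1 else 0) *
      f (fun j => A j ω) (fun j => B j ω)) ∂P =
      q / (n + 1) * ∫ ω, f (fun j => A j ω) (fun j => B j ω) ∂P := by
  have hAm : Measurable fun ω n => A n ω := measurable_pi_lambda _ h.measurable_A
  have hBm : Measurable fun ω n => B n ω := measurable_pi_lambda _ h.measurable_B
  have hC0 : 0 ≤ C := (abs_nonneg _).trans (hC 0 0)
  have hite (p : Prop) [Decidable p] : |if p then (1 : ℝ) else 0| ≤ 1 := by
    split_ifs <;> norm_num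
  rw [integral_comp_eq_of_indepFun hAm hBm h.indep
      (g := fun a c => (if a n = 0 then 1 else 0) * ((if c n = k then 1 else 0) * f a c))
      ?_ (C := C) ?_,
    integral_comp_eq_of_indepFun hAm hBm h.indep (g := f) hf hC]
  · set F : (ℕ → ℕ) → ℝ := fun a => ∫ ω', f a (fun j => B j ω') ∂P with hF
    have hFm : Measurable F := by
      have : StronglyMeasurable (Function.uncurry fun (a : ℕ → ℕ) (ω' : Ω) =>
          f a (fun j => B j ω')) :=
        (hf.comp (measurable_fst.prodMk (hBm.comp measurable_snd))).stronglyMeasurable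
      exact this.integral_prod_right.measurable
    have hinner : ∀ a : ℕ → ℕ, ∫ ω', (if a n = 0 then 1 else 0) *
        ((if B n ω' = k then 1 else 0) * f a (fun j => B j ω')) ∂P =
        1 / ((n : ℝ) + 1) * ((if a n = 0 then 1 else 0) * F a) := by
      intro a
      rw [integral_const_mul, integral_ite_mul_of_iIndepFun h.measurable_B h.indep_B n k
        (F := f a) (hf.comp measurable_prodMk_left) fun z z' hz => hfc a a z z' (fun _ _ => rfl) hz,
        h.prob_B n k hk hkn, hF]
      ring
    refine (integral_congr_ae (Eventually.of_forall fun ω => hinner fun j => A j ω)).trans ?_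
    rw [integral_const_mul, integral_ite_mul_of_iIndepFun h.measurable_A h.indep_A n 0 hFm
      fun z z' hz => integral_congr_ae (Eventually.of_forall fun ω => hfc z z' _ _ hz
        fun _ _ => rfl), h.prob_A]
    ring
  · have h1 : Measurable fun z : (ℕ → ℕ) × (ℕ → ℕ) => if z.1 n = 0 then (1 : ℝ) else 0 :=
      measurable_ite_eq (by fun_prop) 0
    have h2 : Measurable fun z : (ℕ → ℕ) × (ℕ → ℕ) => if z.2 n = k then (1 : ℝ) else 0 :=
      measurable_ite_eq (by fun_prop) k
    exact h1.mul (h2.mul hf)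
  · intro a c
    rw [abs_mul, abs_mul]
    calc _ ≤ 1 * (1 * C) := by gcongr <;> first | exact hite _ | exact hC a c
      _ = C := by ring

/-- One step of the chain: the copied index is uniform and independent of the past. -/
lemma integral_copy (h : IsLabelDriving P q A B) (n : ℕ) {f : ℕ → (ℕ → ℕ) → (ℕ → ℕ) → ℝ}
    (hf : ∀ i, Measurable fun z : (ℕ → ℕ) × (ℕ → ℕ) => f i z.1 z.2) {C : ℝ}
    (hC : ∀ i a c, |f i a c| ≤ C)
    (hfc : ∀ i ≤ n, ∀ a a' c c' : ℕ → ℕ, (∀ j < n, a j = a' j) → (∀ j < n, c j = c' j) →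
      f i a c = f i a' c') :
    ∫ ω, (if A n ω = 0 then f (min (B n ω - 1) n) (fun j => A j ω) (fun j => B j ω) else 0) ∂P =
      q / (n + 1) * ∫ ω, ∑ i ∈ range (n + 1), f i (fun j => A j ω) (fun j => B j ω) ∂P := by
  have hae : (fun ω => if A n ω = 0 then
      f (min (B n ω - 1) n) (fun j => A j ω) (fun j => B j ω) else 0) =ᵐ[P] fun ω =>
      ∑ i ∈ range (n + 1), (if A n ω = 0 then 1 else 0) * ((if B n ω = i + 1 then 1 else 0) *
        f i (fun j => A j ω) (fun j => B j ω)) := by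
    filter_upwards [h.ae_mem_range n] with ω hω
    rw [← mul_sum]
    split_ifs with h0
    · rw [one_mul, sum_eq_single (B n ω - 1)]
      · rw [if_pos (by omega), one_mul, min_eq_left (by omega)]
      · intro i _ hi
        rw [if_neg (by omega), zero_mul]
      · intro hn
        exact absurd (mem_range.2 (by omega)) hn
    · rw [zero_mul]
  have hint : ∀ i, Integrable (fun ω => (if A n ω = 0 then (1 : ℝ) else 0) *
      ((if B n ω = i + 1 then 1 else 0) * f i (fun j => A j ω) (fun j => B j ω))) P := by
    intro i
    have hm1 : Measurable fun ω => if A n ω = 0 then (1 : ℝ) else 0 :=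
      measurable_ite_eq (h.measurable_A n) 0
    have hm2 : Measurable fun ω => if B n ω = i + 1 then (1 : ℝ) else 0 :=
      measurable_ite_eq (h.measurable_B n) (i + 1)
    refine ((h.integrable_comp (hf i) (hC i)).bdd_mul (c := 1) hm2.aestronglyMeasurable
      (Eventually.of_forall fun ω => ?_)).bdd_mul (c := 1) hm1.aestronglyMeasurable
      (Eventually.of_forall fun ω => ?_)
    · split_ifs <;> simp
    · split_ifs <;> simp
  rw [integral_congr_ae hae, integral_finsetSum _ fun i _ => hint i,
    integral_finsetSum _ fun i _ => h.integrable_comp (hf i) (hC i), mul_sum]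
  refine sum_congr rfl fun i hi => ?_
  rw [mem_range] at hi
  exact h.integral_ite_ite_mul n (by omega) (by omega) (hf i) (hC i) (hfc i (by omega))

end IsLabelDriving

end StepReinforced

namespace StepReinforced

open Finset Filter

/-! ### Exact recursions for the moments of the label counts -/

namespace IsLabelDriving

variable {Ω : Type*} [MeasurableSpace Ω] {P : Measure Ω} [IsProbabilityMeasure P] {q : ℝ}
  {A B : ℕ → Ω → ℕ}

lemma integrable_mult (h : IsLabelDriving P q A B) (n i : ℕ) :
    Integrable (fun ω => mult (fun j => A j ω) (fun j => B j ω) n i) P :=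
  h.integrable_comp (f := fun a c => mult a c n i) (measurable_mult n i) fun a c => by
    rw [abs_of_nonneg (mult_nonneg a c n i)]; exact mult_le a c n i

lemma integrable_mult_sq (h : IsLabelDriving P q A B) (n i : ℕ) :
    Integrable (fun ω => mult (fun j => A j ω) (fun j => B j ω) n i ^ 2) P :=
  h.integrable_comp (f := fun a c => mult a c n i ^ 2) ((measurable_mult n i).pow_const 2)
    (C := ((n : ℝ) + 1) ^ 2) fun a c => by
    rw [abs_of_nonneg (sq_nonneg _)]
    exact pow_le_pow_left₀ (mult_nonneg a c n i) (mult_le a c n i) 2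

lemma integrable_sqSum (h : IsLabelDriving P q A B) (n : ℕ) :
    Integrable (fun ω => sqSum (fun j => A j ω) (fun j => B j ω) n) P :=
  integrable_finsetSum _ fun i _ => h.integrable_mult n i

lemma integrable_cubeSum (h : IsLabelDriving P q A B) (n : ℕ) :
    Integrable (fun ω => cubeSum (fun j => A j ω) (fun j => B j ω) n) P :=
  integrable_finsetSum _ fun i _ => h.integrable_mult_sq n i

lemma abs_sqSum_mul_mult_le (a c : ℕ → ℕ) (n i : ℕ) :
    |sqSum a c n * mult a c n i| ≤ ((n : ℝ) + 1) ^ 2 * (n + 1) := by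
  rw [abs_of_nonneg (mul_nonneg (sqSum_nonneg a c n) (mult_nonneg a c n i))]
  exact mul_le_mul (sqSum_le a c n) (mult_le a c n i) (mult_nonneg a c n i) (by positivity)

lemma integrable_sqSum_mul_mult (h : IsLabelDriving P q A B) (n i : ℕ) :
    Integrable (fun ω => sqSum (fun j => A j ω) (fun j => B j ω) n *
      mult (fun j => A j ω) (fun j => B j ω) n i) P :=
  h.integrable_comp (f := fun a c => sqSum a c n * mult a c n i)
    ((measurable_sqSum n).mul (measurable_mult n i)) fun a c => abs_sqSum_mul_mult_le a c n i

lemma integrable_sqSum_sq (h : IsLabelDriving P q A B) (n : ℕ) :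
    Integrable (fun ω => sqSum (fun j => A j ω) (fun j => B j ω) n ^ 2) P :=
  h.integrable_comp (f := fun a c => sqSum a c n ^ 2) ((measurable_sqSum n).pow_const 2)
    (C := (((n : ℝ) + 1) ^ 2) ^ 2) fun a c => by
    rw [abs_of_nonneg (sq_nonneg _)]
    exact pow_le_pow_left₀ (sqSum_nonneg a c n) (sqSum_le a c n) 2

lemma integral_mult_succ (h : IsLabelDriving P q A B) (n : ℕ) :
    ∫ ω, mult (fun j => A j ω) (fun j => B j ω) n (n + 1) ∂P =
      q / (n + 1) * ∫ ω, sqSum (fun j => A j ω) (fun j => B j ω) n ∂P := by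
  simp_rw [mult_self_succ]
  exact h.integral_copy n (f := fun i a c => mult a c n i) (measurable_mult n)
    (C := (n : ℝ) + 1) (fun i a c => by
      rw [abs_of_nonneg (mult_nonneg a c n i)]; exact mult_le a c n i)
    fun i hi a a' c c' ha hc => mult_congr ha hc hi

lemma integral_mult_succ_sq (h : IsLabelDriving P q A B) (n : ℕ) :
    ∫ ω, mult (fun j => A j ω) (fun j => B j ω) n (n + 1) ^ 2 ∂P =
      q / (n + 1) * ∫ ω, cubeSum (fun j => A j ω) (fun j => B j ω) n ∂P := by
  have := h.integral_copy n (f := fun i a c => mult a c n i ^ 2)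
    (fun i => (measurable_mult n i).pow_const 2) (C := ((n : ℝ) + 1) ^ 2) (fun i a c => by
      rw [abs_of_nonneg (sq_nonneg _)]
      exact pow_le_pow_left₀ (mult_nonneg a c n i) (mult_le a c n i) 2)
    fun i hi a a' c c' ha hc => by rw [mult_congr ha hc hi]
  rw [show (fun ω => cubeSum (fun j => A j ω) (fun j => B j ω) n) = fun ω =>
    ∑ i ∈ range (n + 1), mult (fun j => A j ω) (fun j => B j ω) n i ^ 2 from rfl, ← this]
  congr 1 with ω
  rw [mult_self_succ]
  split_ifs <;> simp

lemma integral_sqSum_mul_mult_succ (h : IsLabelDriving P q A B) (n : ℕ) :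
    ∫ ω, sqSum (fun j => A j ω) (fun j => B j ω) n *
        mult (fun j => A j ω) (fun j => B j ω) n (n + 1) ∂P =
      q / (n + 1) * ∫ ω, sqSum (fun j => A j ω) (fun j => B j ω) n ^ 2 ∂P := by
  have := h.integral_copy n (f := fun i a c => sqSum a c n * mult a c n i)
    (fun i => (measurable_sqSum n).mul (measurable_mult n i))
    (fun i a c => abs_sqSum_mul_mult_le a c n i)
    fun i hi a a' c c' ha hc => by rw [sqSum_congr ha hc, mult_congr ha hc hi]
  have e : ∀ ω, sqSum (fun j => A j ω) (fun j => B j ω) n ^ 2 = ∑ i ∈ range (n + 1),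
      sqSum (fun j => A j ω) (fun j => B j ω) n * mult (fun j => A j ω) (fun j => B j ω) n i := by
    intro ω
    rw [← mul_sum, sq]
    rfl
  simp_rw [e]
  rw [← this]
  congr 1 with ω
  rw [mult_self_succ]
  split_ifs <;> simp

lemma integral_sqSum (h : IsLabelDriving P q A B) (n : ℕ) :
    ∫ ω, sqSum (fun j => A j ω) (fun j => B j ω) n ∂P = sqMean q n := by
  induction n with
  | zero => simp [sqSum_zero, sqMean]
  | succ n ih =>
    simp_rw [sqSum_succ]
    have hi1 := h.integrable_sqSum n
    have hi2 := (h.integrable_mult n (n + 1)).const_mul 2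
    rw [integral_add (hi1.fun_add hi2) (integrable_const _), integral_add hi1 hi2, integral_const_mul,
      h.integral_mult_succ, ih, sqMean]
    simp
    ring

lemma integral_cubeSum (h : IsLabelDriving P q A B) (n : ℕ) :
    ∫ ω, cubeSum (fun j => A j ω) (fun j => B j ω) n ∂P = cubeMean q n := by
  induction n with
  | zero => simp [cubeSum_zero, cubeMean]
  | succ n ih =>
    simp_rw [cubeSum_succ]
    have hi1 := h.integrable_cubeSum n
    have hi2 := (h.integrable_mult_sq n (n + 1)).const_mul 3
    have hi3 := (h.integrable_mult n (n + 1)).const_mul 3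
    rw [integral_add ((hi1.fun_add hi2).fun_add hi3) (integrable_const _),
      integral_add (hi1.fun_add hi2) hi3, integral_add hi1 hi2, integral_const_mul, integral_const_mul,
      h.integral_mult_succ, h.integral_mult_succ_sq, ih, h.integral_sqSum, cubeMean]
    simp
    ring

lemma integral_sqSum_succ_sq (h : IsLabelDriving P q A B) (n : ℕ) :
    ∫ ω, sqSum (fun j => A j ω) (fun j => B j ω) (n + 1) ^ 2 ∂P =
      (1 + 4 * (q / (n + 1))) * ∫ ω, sqSum (fun j => A j ω) (fun j => B j ω) n ^ 2 ∂P +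
        (2 + 4 * (q / (n + 1))) * sqMean q n + 4 * (q / (n + 1)) * cubeMean q n + 1 := by
  have e : ∀ a c, sqSum a c (n + 1) ^ 2 = sqSum a c n ^ 2 + 4 * (sqSum a c n * mult a c n (n + 1))
      + 4 * mult a c n (n + 1) ^ 2 + 2 * sqSum a c n + 4 * mult a c n (n + 1) + 1 := by
    intro a c
    rw [sqSum_succ]; ring
  simp_rw [e]
  have hi1 := h.integrable_sqSum_sq n
  have hi2 := (h.integrable_sqSum_mul_mult n (n + 1)).const_mul 4
  have hi3 := (h.integrable_mult_sq n (n + 1)).const_mul 4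
  have hi4 := (h.integrable_sqSum n).const_mul 2
  have hi5 := (h.integrable_mult n (n + 1)).const_mul 4
  rw [integral_add ((((hi1.fun_add hi2).fun_add hi3).fun_add hi4).fun_add hi5) (integrable_const _),
    integral_add (((hi1.fun_add hi2).fun_add hi3).fun_add hi4) hi5,
    integral_add ((hi1.fun_add hi2).fun_add hi3) hi4, integral_add (hi1.fun_add hi2) hi3,
    integral_add hi1 hi2, integral_const_mul, integral_const_mul, integral_const_mul,
    integral_const_mul, h.integral_mult_succ, h.integral_mult_succ_sq,
    h.integral_sqSum_mul_mult_succ, h.integral_sqSum, h.integral_cubeSum]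
  simp
  ring

lemma isVarianceSeq (h : IsLabelDriving P q A B) :
    IsVarianceSeq q fun n =>
      ∫ ω, sqSum (fun j => A j ω) (fun j => B j ω) n ^ 2 ∂P - sqMean q n ^ 2 := by
  constructor
  · simp [sqSum_zero, sqMean]
  · intro n
    simp only
    rw [h.integral_sqSum_succ_sq n, sqMean]
    -- The squared mean contains the extra term 4 (q / (n + 1) · sqMean)²; discarding it turns the
    -- identity into the required inequality.
    have : 0 ≤ (q / (n + 1) * sqMean q n) ^ 2 := sq_nonneg _
    have e1 : 2 * q / ((n : ℝ) + 1) = 2 * (q / (n + 1)) := by ring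
    have e2 : 4 * q / ((n : ℝ) + 1) = 4 * (q / (n + 1)) := by ring
    rw [e1, e2]
    nlinarith

/-- The second moment of the relative error of `∑ N_j²` as an approximation of `β`. -/
lemma integral_sq_relative_error (h : IsLabelDriving P q A B) (n : ℕ) {β : ℝ} (hβ : β ≠ 0) :
    ∫ ω, (sqSum (fun j => A j ω) (fun j => B j ω) n / β - 1) ^ 2 ∂P =
      (∫ ω, sqSum (fun j => A j ω) (fun j => B j ω) n ^ 2 ∂P - sqMean q n ^ 2) / β ^ 2 +
        ((sqMean q n - β) / β) ^ 2 := by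
  have e : ∀ a c, (sqSum a c n / β - 1) ^ 2 =
      (β ^ 2)⁻¹ * sqSum a c n ^ 2 + -2 / β * sqSum a c n + 1 := by
    intro a c
    field_simp
    ring
  simp_rw [e]
  have hi1 := (h.integrable_sqSum_sq n).const_mul (β ^ 2)⁻¹
  have hi2 := (h.integrable_sqSum n).const_mul (-2 / β)
  rw [integral_add (hi1.fun_add hi2) (integrable_const _), integral_add hi1 hi2, integral_const_mul,
    integral_const_mul, h.integral_sqSum]
  simp
  field_simp
  ring

end IsLabelDriving

end StepReinforced

namespace StepReinforced

open Real Filter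

/-! ### Normal approximation given the labels -/

/-- Conditionally on the labels, the walk is approximately normal with variance `∑ N_j²`; expand
its distribution function around the variance `β`. -/
lemma exists_conditional_bound (μ : Measure ℝ) [IsProbabilityMeasure μ]
    (hμ : Integrable (fun x : ℝ => |x| ^ 3) μ) (hσ : 0 < Var[id; μ]) :
    ∃ C : ℝ, 0 < C ∧ ∀ (Ω : Type*) [MeasurableSpace Ω] (P : Measure Ω) [IsProbabilityMeasure P]
      (X : ℕ → Ω → ℝ), (∀ n, Measurable (X n)) → (∀ n, P.map (X n) = μ) → iIndepFun X P →
      ∀ (a c : ℕ → ℕ) (n : ℕ) (β : ℝ), 0 < β → ∀ x : ℝ,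
      |P.real {ω | ∑ i ∈ Finset.range (n + 1), X (label a c i) ω - (∫ x, x ∂μ) * (n + 1) ≤
          √(Var[id; μ]) * √β * x} - cdf (gaussianReal 0 1) x +
          x * gaussianPDFReal 0 1 x / 2 * (sqSum a c n / β - 1)| ≤
        C * (cubeSum a c n / (β * √β)) + 9 * (sqSum a c n / β - 1) ^ 2 := by
  obtain ⟨C, hC, h⟩ := exists_berry_esseen_weighted μ hμ hσ
  refine ⟨4 * C, by positivity, ?_⟩
  intro Ω _ P _ X hXm hXl hXi a c n β hβ x
  have hV := sqSum_pos a c n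
  have hT := cubeSum_nonneg a c n
  have hbe := h Ω P X hXm hXl hXi (labels a c n) (fun j => (labelCount a c n j : ℝ)) (sqSum a c n)
    (sqSum_eq_sum_labels a c n) hV (x / √(1 + (sqSum a c n / β - 1)))
  rw [← cubeSum_eq_sum_labels] at hbe
  have htay := abs_cdf_gaussianReal_div_sqrt_sub_le x
    (show -1 < sqSum a c n / β - 1 by have : 0 < sqSum a c n / β := by positivity
                                      linarith)
  have hset : {ω | ∑ j ∈ labels a c n, (labelCount a c n j : ℝ) * (X j ω - ∫ x, x ∂μ) ≤
      √(Var[id; μ]) * √(sqSum a c n) * (x / √(1 + (sqSum a c n / β - 1)))} =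
      {ω | ∑ i ∈ Finset.range (n + 1), X (label a c i) ω - (∫ x, x ∂μ) * (n + 1) ≤
          √(Var[id; μ]) * √β * x} := by
    have e1 : √(Var[id; μ]) * √(sqSum a c n) * (x / √(1 + (sqSum a c n / β - 1))) =
        √(Var[id; μ]) * √β * x := by
      rw [add_sub_cancel, sqrt_div hV.le]
      have h1 : √(sqSum a c n) ≠ 0 := (sqrt_pos.2 hV).ne'
      have h2 : √β ≠ 0 := (sqrt_pos.2 hβ).ne'
      field_simp
    have e2 : ∀ ω, ∑ j ∈ labels a c n, (labelCount a c n j : ℝ) * (X j ω - ∫ x, x ∂μ) =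
        ∑ i ∈ Finset.range (n + 1), X (label a c i) ω - (∫ x, x ∂μ) * (n + 1) := by
      intro ω
      rw [← sum_label_eq a c n fun j => X j ω - ∫ x, x ∂μ, Finset.sum_sub_distrib]
      simp
      ring
    simp_rw [e1, e2]
  rw [hset] at hbe
  set p₀ := P.real {ω | ∑ i ∈ Finset.range (n + 1), X (label a c i) ω - (∫ x, x ∂μ) * (n + 1) ≤
    √(Var[id; μ]) * √β * x}
  set Φ := cdf (gaussianReal 0 1) (x / √(1 + (sqSum a c n / β - 1)))
  set r := sqSum a c n / β - 1
  have htri : |p₀ - cdf (gaussianReal 0 1) x + x * gaussianPDFReal 0 1 x / 2 * r| ≤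
      |p₀ - Φ| + 5 * r ^ 2 := by
    have e : p₀ - cdf (gaussianReal 0 1) x + x * gaussianPDFReal 0 1 x / 2 * r =
      (p₀ - Φ) + (Φ - cdf (gaussianReal 0 1) x + x * gaussianPDFReal 0 1 x / 2 * r) := by ring
    rw [e]
    exact (abs_add_le _ _).trans (add_le_add le_rfl htay)
  refine htri.trans ?_
  -- If V ≥ β/2, replacing V^(3/2) by β^(3/2) costs a factor 4. Otherwise r < -1/2, so the trivial
  -- bound 1 ≤ 4 r² replaces Berry–Esseen; with the Taylor remainder 5 r² this gives the coefficient
  -- 9.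
  rcases le_or_gt (β / 2) (sqSum a c n) with hle | hlt
  · have h1 := div_mul_sqrt_le (c := cubeSum a c n) (t := cubeSum a c n) (K := 1) hβ (by simp) hT
      zero_le_one hle
    rw [rpow_neg hβ.le, ← mul_sqrt_eq_rpow hβ, ← div_eq_mul_inv] at h1
    have h2 := mul_le_mul_of_nonneg_left h1 hC.le
    nlinarith [sq_nonneg r]
  · have hr2 : r < -(1 / 2) := by
      have : sqSum a c n / β < 1 / 2 := by rw [div_lt_iff₀ hβ]; linarith
      linarith
    have h1 : |p₀ - Φ| ≤ 1 := by
      have h2 := cdf_nonneg (gaussianReal 0 1) (x / √(1 + r))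
      have h3 := cdf_le_one (gaussianReal 0 1) (x / √(1 + r))
      have h4 : 0 ≤ p₀ := measureReal_nonneg
      have h5 : p₀ ≤ 1 := measureReal_le_one
      rw [abs_le]; constructor <;> linarith
    have h2 : 0 ≤ 4 * C * (cubeSum a c n / (β * √β)) := by positivity
    nlinarith

/-- The distribution function of the walk in terms of the moments of the label counts. -/
lemma exists_distribution_bound (μ : Measure ℝ) [IsProbabilityMeasure μ]
    (hμ : Integrable (fun x : ℝ => |x| ^ 3) μ) (hσ : 0 < Var[id; μ]) :
    ∃ C : ℝ, 0 < C ∧ ∀ (Ω : Type*) [MeasurableSpace Ω] (P : Measure Ω) [IsProbabilityMeasure P]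
      (X : ℕ → Ω → ℝ) (A B : ℕ → Ω → ℕ) (q : ℝ),
      (∀ n, Measurable (X n)) → (∀ n, P.map (X n) = μ) → iIndepFun X P →
      IsLabelDriving P q A B →
      IndepFun (fun ω => ((fun n => A n ω), (fun n => B n ω))) (fun ω n => X n ω) P →
      ∀ (n : ℕ) (β : ℝ), 0 < β → ∀ x : ℝ,
      |P.real {ω | ∑ i ∈ Finset.range (n + 1), X (label (fun j => A j ω) (fun j => B j ω) i) ω -
          (∫ x, x ∂μ) * (n + 1) ≤ √(Var[id; μ]) * √β * x} - cdf (gaussianReal 0 1) x| ≤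
        C * (cubeMean q n / (β * √β)) +
          9 * ((∫ ω, sqSum (fun j => A j ω) (fun j => B j ω) n ^ 2 ∂P - sqMean q n ^ 2) / β ^ 2 +
            ((sqMean q n - β) / β) ^ 2) + |sqMean q n - β| / β := by
  obtain ⟨C, hC, h⟩ := exists_conditional_bound μ hμ hσ
  refine ⟨C, hC, ?_⟩
  intro Ω _ P _ X A B q hXm hXl hXi hAB hind n β hβ x
  set m := ∫ x, x ∂μ
  set y := √(Var[id; μ]) * √β * x
  set S : Set (((ℕ → ℕ) × (ℕ → ℕ)) × (ℕ → ℝ)) :=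
    {z | ∑ i ∈ Finset.range (n + 1), z.2 (label z.1.1 z.1.2 i) - m * (n + 1) ≤ y}
  have hSm : MeasurableSet S :=
    measurableSet_le ((measurable_sum_apply_label n).sub_const _) measurable_const
  have hXs : Measurable fun ω n => X n ω := measurable_pi_lambda _ hXm
  set g : ((ℕ → ℕ) × (ℕ → ℕ)) → (ℕ → ℝ) → ℝ := fun z w => S.indicator 1 (z, w) with hg
  have hgm : Measurable (Function.uncurry g) := measurable_one.indicator hSm
  have hg1 : ∀ z w, |g z w| ≤ 1 := fun z w => by
    simp only [hg, Set.indicator]; split_ifs <;> simp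
  -- The conditional distribution function of the centred walk given the labels, as a function of
  -- the driving paths.
  set G : (ℕ → ℕ) → (ℕ → ℕ) → ℝ := fun a c =>
    P.real {ω | ∑ i ∈ Finset.range (n + 1), X (label a c i) ω - m * (n + 1) ≤ y} with hG
  have hGg : ∀ a c, G a c = ∫ ω, g (a, c) (fun n => X n ω) ∂P := fun a c => by
    have hm : MeasurableSet
        {ω | ∑ i ∈ Finset.range (n + 1), X (label a c i) ω - m * (n + 1) ≤ y} :=
      measurableSet_le ((Finset.measurable_fun_sum _ fun i _ => hXm _).sub_const _)
        measurable_const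
    rw [hG]
    simp only
    rw [← integral_indicator_one hm]
    rfl
  have hGm : Measurable fun z : (ℕ → ℕ) × (ℕ → ℕ) => G z.1 z.2 := by
    have : StronglyMeasurable (Function.uncurry fun (z : (ℕ → ℕ) × (ℕ → ℕ)) (ω : Ω) =>
        g z (fun n => X n ω)) :=
      (hgm.comp (measurable_fst.prodMk (hXs.comp measurable_snd))).stronglyMeasurable
    simp_rw [hGg]
    exact this.integral_prod_right.measurable
  have hprob : P.real {ω | ∑ i ∈ Finset.range (n + 1),
      X (label (fun j => A j ω) (fun j => B j ω) i) ω - m * (n + 1) ≤ y} =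
      ∫ ω, G (fun j => A j ω) (fun j => B j ω) ∂P := by
    have hm : MeasurableSet {ω | ∑ i ∈ Finset.range (n + 1),
        X (label (fun j => A j ω) (fun j => B j ω) i) ω - m * (n + 1) ≤ y} :=
      (hAB.measurable_pair.prodMk hXs) hSm
    simp_rw [hGg]
    rw [← integral_comp_eq_of_indepFun hAB.measurable_pair hXs hind hgm hg1,
      ← integral_indicator_one hm]
    rfl
  set V : Ω → ℝ := fun ω => sqSum (fun j => A j ω) (fun j => B j ω) n with hV
  set T : Ω → ℝ := fun ω => cubeSum (fun j => A j ω) (fun j => B j ω) n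
  set ψ := x * gaussianPDFReal 0 1 x
  have hψ1 : |ψ| ≤ 1 := abs_mul_gaussianPDFReal_le x
  have hiG : Integrable (fun ω => G (fun j => A j ω) (fun j => B j ω)) P :=
    hAB.integrable_comp hGm (C := 1) fun a c => by
      rw [abs_of_nonneg measureReal_nonneg]; exact measureReal_le_one
  have hir : Integrable (fun ω => V ω / β - 1) P :=
    ((hAB.integrable_sqSum n).div_const β).sub (integrable_const 1)
  have hir2 : Integrable (fun ω => (V ω / β - 1) ^ 2) P := by
    refine (((hAB.integrable_sqSum_sq n).const_mul (β ^ 2)⁻¹).add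
      (((hAB.integrable_sqSum n).const_mul (-2 / β)).add (integrable_const 1))).congr
      (Eventually.of_forall fun ω => ?_)
    simp only [Pi.add_apply, hV]
    field_simp
    ring
  have hiT : Integrable (fun ω => C * (T ω / (β * √β))) P :=
    ((hAB.integrable_cubeSum n).div_const _).const_mul C
  have hmean : ∫ ω, (V ω / β - 1) ∂P = (sqMean q n - β) / β := by
    rw [integral_sub ((hAB.integrable_sqSum n).div_const β) (integrable_const 1), integral_div,
      hAB.integral_sqSum]
    simp
    field_simp
  -- The linear term is integrated with its sign, so the fluctuations of V disappear from it and
  -- only the bias of its mean is left.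
  have hLHS : ∫ ω, (G (fun j => A j ω) (fun j => B j ω) - cdf (gaussianReal 0 1) x +
      ψ / 2 * (V ω / β - 1)) ∂P = ∫ ω, G (fun j => A j ω) (fun j => B j ω) ∂P -
        cdf (gaussianReal 0 1) x + ψ / 2 * ((sqMean q n - β) / β) := by
    have hi0 : Integrable (fun ω => G (fun j => A j ω) (fun j => B j ω) -
        cdf (gaussianReal 0 1) x) P := hiG.sub (integrable_const _)
    rw [integral_add hi0 (hir.const_mul _),
      integral_sub hiG (integrable_const _), integral_const_mul, hmean]
    simp
  have hRHS : ∫ ω, (C * (T ω / (β * √β)) + 9 * (V ω / β - 1) ^ 2) ∂P =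
      C * (cubeMean q n / (β * √β)) +
        9 * ((∫ ω, V ω ^ 2 ∂P - sqMean q n ^ 2) / β ^ 2 + ((sqMean q n - β) / β) ^ 2) := by
    rw [integral_add hiT (hir2.const_mul 9), integral_const_mul, integral_const_mul, integral_div,
      hAB.integral_cubeSum, hAB.integral_sq_relative_error n hβ.ne']
  have hbound := norm_integral_le_of_norm_le (f := fun ω =>
      G (fun j => A j ω) (fun j => B j ω) - cdf (gaussianReal 0 1) x + ψ / 2 * (V ω / β - 1))
    (hiT.add (hir2.const_mul 9))
    (Eventually.of_forall fun ω => h Ω P X hXm hXl hXi (fun j => A j ω) (fun j => B j ω) n β hβ x)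
  have hbound' : |∫ ω, G (fun j => A j ω) (fun j => B j ω) ∂P - cdf (gaussianReal 0 1) x +
      ψ / 2 * ((sqMean q n - β) / β)| ≤ C * (cubeMean q n / (β * √β)) +
        9 * ((∫ ω, V ω ^ 2 ∂P - sqMean q n ^ 2) / β ^ 2 + ((sqMean q n - β) / β) ^ 2) := by
    rw [← hLHS, ← hRHS]
    exact hbound
  rw [hprob]
  have hlast : |ψ / 2 * ((sqMean q n - β) / β)| ≤ |sqMean q n - β| / β := by
    rw [abs_mul, abs_div, abs_div, abs_two, abs_of_pos hβ]
    have : 0 ≤ |sqMean q n - β| / β := by positivity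
    nlinarith
  rw [abs_le] at hbound' hlast ⊢
  constructor <;> linarith [hbound'.1, hbound'.2, hlast.1, hlast.2]

/-! ### The Berry–Esseen bound for the walk -/

section Driving

variable {Ω : Type*} [MeasurableSpace Ω] {P : Measure Ω} {μ : Measure ℝ}
  {p : ℝ} {X : ℕ → Ω → ℝ} {ε U : ℕ → Ω → ℕ}

lemma IsDriving.isLabelDriving (h : IsDriving P μ p X ε U) (hp1 : p ≤ 1) :
    IsLabelDriving P (1 - p) (fun n => ε (n + 2)) (fun n => U (n + 2)) where
  measurable_A n := h.measurable_ε _ (by omega)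
  measurable_B n := h.measurable_U _ (by omega)
  indep_A := h.indep_ε
  indep_B := h.indep_U
  indep := h.indep_ε_U
  prob_A n := by
    rw [measureReal_def, h.law_ε_zero _ (by omega), ENNReal.toReal_ofReal (by linarith)]
  prob_B n k hk hkn := by
    have e : ((n + 2 : ℕ) : ℝ) - 1 = (n : ℝ) + 1 := by push_cast; ring
    rw [measureReal_def, h.law_U (n + 2) (by omega) k hk (by omega), e,
      ENNReal.toReal_ofReal (by positivity)]

lemma IsDriving.ae_walk_eq [IsProbabilityMeasure P] (h : IsDriving P μ p X ε U) (hp1 : p ≤ 1) (n : ℕ) :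
    ∀ᵐ ω ∂P, walk (fun j => X j ω) (fun j => ε j ω) (fun j => U j ω) (n + 1) =
      ∑ i ∈ Finset.range (n + 1),
        X (label (fun j => ε (j + 2) ω) (fun j => U (j + 2) ω) i + 1) ω := by
  have hae : ∀ᵐ ω ∂P, ∀ k, 1 ≤ U (k + 2) ω ∧ U (k + 2) ω ≤ k + 1 :=
    ae_all_iff.2 fun k => (h.isLabelDriving hp1).ae_mem_range k
  filter_upwards [hae] with ω hω
  exact walk_add_one_eq (fun j => X j ω) (h.ε_one ω) fun k _ => hω k

lemma kolmogorovDist_le_one (P : Measure Ω) [IsProbabilityMeasure P] (Y : Ω → ℝ) :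
    kolmogorovDist P Y ≤ 1 := by
  refine ciSup_le fun x => ?_
  have h1 := cdf_nonneg (gaussianReal 0 1) x
  have h2 := cdf_le_one (gaussianReal 0 1) x
  have h3 : 0 ≤ P.real {ω | Y ω ≤ x} := measureReal_nonneg
  have h4 : P.real {ω | Y ω ≤ x} ≤ 1 := measureReal_le_one
  rw [abs_le]; constructor <;> linarith

end Driving

lemma exists_kolmogorovDist_bound_of_large (p : ℝ) (hp : 1 / 2 ≤ p) (hp1 : p < 1)
    (μ : Measure ℝ) [IsProbabilityMeasure μ]
    (hμ : Integrable (fun x : ℝ => |x| ^ 3) μ) (hσ : 0 < Var[id; μ]) :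
    ∃ C : ℝ, 0 < C ∧ ∃ N : ℕ,
      ∀ (Ω : Type*) [MeasurableSpace Ω] (P : Measure Ω) [IsProbabilityMeasure P]
        (X : ℕ → Ω → ℝ) (ε U : ℕ → Ω → ℕ), IsDriving P μ p X ε U → ∀ n ≥ N,
          kolmogorovDist P (fun ω =>
              (walk (fun j => X j ω) (fun j => ε j ω) (fun j => U j ω) (n + 1)
                  - (∫ x, x ∂μ) * (n + 1 : ℕ)) / (√(Var[id; μ]) * √(b p (n + 1))))
            ≤ C * rate p (n + 1) := by
  obtain ⟨C, hC, h⟩ := exists_distribution_bound μ hμ hσ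
  obtain ⟨K, hK, N, hN⟩ := exists_errorBound hp hp1
  obtain ⟨K₀, hK₀, hv⟩ := exists_abs_sqMean_sub_b_le hp hp1
  refine ⟨C * K + 9 * (K + K₀ ^ 2 * K) + K₀ * K, by positivity, N, ?_⟩
  intro Ω _ P _ X ε U hD n hn
  have hL := hD.isLabelDriving hp1.le
  obtain ⟨hb1, ht, hx, hb⟩ := hN _ hL.isVarianceSeq n hn
  have hv := hv n
  set β := b p (n + 1)
  set R := rate p (n + 1)
  have hβ : 0 < β := by linarith
  have hσβ : 0 < √(Var[id; μ]) * √β := mul_pos (sqrt_pos.2 hσ) (sqrt_pos.2 hβ)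
  refine ciSup_le fun x => ?_
  have hprob : P.real {ω | (walk (fun j => X j ω) (fun j => ε j ω) (fun j => U j ω) (n + 1)
      - (∫ x, x ∂μ) * (n + 1 : ℕ)) / (√(Var[id; μ]) * √β) ≤ x} =
      P.real {ω | ∑ i ∈ Finset.range (n + 1),
        X (label (fun j => ε (j + 2) ω) (fun j => U (j + 2) ω) i + 1) ω -
          (∫ x, x ∂μ) * (n + 1) ≤ √(Var[id; μ]) * √β * x} := by
    refine measureReal_congr ?_
    filter_upwards [hD.ae_walk_eq hp1.le n] with ω hω
    refine propext ?_
    change (_ / _ ≤ x) ↔ (_ ≤ _)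
    rw [hω, div_le_iff₀ hσβ, mul_comm x]
    push_cast
    rfl
  rw [hprob]
  refine (h Ω P (fun n => X (n + 1)) _ _ (1 - p) (fun n => hD.measurable_X _ (by omega))
    (fun n => hD.law_X _ (by omega)) hD.indep_X hL hD.indep_X_εU.symm n β hβ x).trans ?_
  have h1 : C * (cubeMean (1 - p) n / (β * √β)) ≤ C * (K * R) := by gcongr
  have hKR : 0 ≤ K * R := le_trans (by positivity) hb
  have h2 : |sqMean (1 - p) n - β| / β ≤ K₀ * (K * R) := by
    calc |sqMean (1 - p) n - β| / β ≤ K₀ / β := by gcongr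
      _ = K₀ * (1 / β) := by ring
      _ ≤ _ := by gcongr
  have h3 : ((sqMean (1 - p) n - β) / β) ^ 2 ≤ K₀ ^ 2 * (K * R) := by
    rw [div_pow, ← sq_abs]
    -- β ≥ 1 gives β² ≥ β.
    calc |sqMean (1 - p) n - β| ^ 2 / β ^ 2 ≤ K₀ ^ 2 / β := by
          gcongr
          nlinarith
      _ = K₀ ^ 2 * (1 / β) := by ring
      _ ≤ _ := by gcongr
  nlinarith

end StepReinforced

/-! ### Conclusion: small times -/

theorem mainTheorem1 (p : ℝ) (hp : 1 / 2 ≤ p) (hp1 : p < 1)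
    (μ : Measure ℝ) [IsProbabilityMeasure μ]
    (hμ : Integrable (fun x : ℝ => |x| ^ 3) μ) (hσ : 0 < Var[id; μ]) :
    ∃ C : ℝ, 0 < C ∧
      ∀ (Ω : Type*) [MeasurableSpace Ω] (P : Measure Ω) [IsProbabilityMeasure P]
        (X : ℕ → Ω → ℝ) (ε U : ℕ → Ω → ℕ),
        StepReinforced.IsDriving P μ p X ε U →
        ∀ n : ℕ, 1 ≤ n → (n = 1 → p ≠ 1 / 2 ∧ p ≠ 2 / 3) →
          StepReinforced.kolmogorovDist P
            (fun ω =>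
              (StepReinforced.walk (fun j => X j ω) (fun j => ε j ω) (fun j => U j ω) n
                  - (∫ x, x ∂μ) * n)
                / (√(Var[id; μ]) * √(StepReinforced.b p n)))
            ≤ C * StepReinforced.rate p n := by
  obtain ⟨C, hC, N, h⟩ := StepReinforced.exists_kolmogorovDist_bound_of_large p hp hp1 μ hμ hσ
  have hS : 0 ≤ ∑ k ∈ Finset.range N, |(StepReinforced.rate p (k + 1))⁻¹| := by positivity
  -- For each of the finitely many small times the distance is at most 1 = rate⁻¹ · rate, and the
  -- sum dominates every such rate⁻¹.
  refine ⟨C + ∑ k ∈ Finset.range N, |(StepReinforced.rate p (k + 1))⁻¹|, by positivity, ?_⟩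
  intro Ω _ P _ X ε U hD n hn hn1
  have hr := StepReinforced.rate_pos hn hn1 hp
  obtain ⟨k, rfl⟩ : ∃ k, n = k + 1 := ⟨n - 1, by omega⟩
  rcases le_or_gt N k with hk | hk
  · refine (h Ω P X ε U hD k hk).trans ?_
    gcongr
    linarith
  · refine (StepReinforced.kolmogorovDist_le_one P _).trans ?_
    have h1 := Finset.single_le_sum (f := fun k => |(StepReinforced.rate p (k + 1))⁻¹|)
      (fun _ _ => abs_nonneg _) (Finset.mem_range.2 hk)
    calc (1 : ℝ) = |(StepReinforced.rate p (k + 1))⁻¹| * StepReinforced.rate p (k + 1) := by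
          rw [abs_of_pos (inv_pos.2 hr), inv_mul_cancel₀ hr.ne']
      _ ≤ _ := by
          gcongr
          linarith
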